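/- Let $K\subset\mathbb{R}^n$ be an unbounded convex polyhedron (a finite intersection of closed half-spaces) whose recession cone $\{v\in\mathbb{R}^n : p+tv\in K \text{ for all } p\in K,\ t\ge 0\}$ has dimension $n$. If $\{H_1^+,\dots,H_m^+\}$ is the unique minimal family of closed half-spaces with intersection $K$, bounded by the hyperplanes $H_1,\dots,H_m$, then the facets of $K$ are the sets $K\cap H_i$; the facets of a lower-dimensional polyhedron are defined in the same way inside the affine subspace that it spans, and the $(n-2)$-dimensional faces of $K$ are the facets of its facets. Let $X$ be the union of the affine subspaces of $\mathbb{R}^n$ spanned by the $(n-2)$-dimensional faces of $K$, and write $\operatorname{Int}(S)$ for the interior of a convex set $S$ relative to the affine subspace that it spans. Let $F$ be an unbounded facet of $K$, let $\mathcal{G}$ be any (possibly empty) set of facets of $K$ with $F\notin\mathcal{G}$, and let $$T=(K\setminus X)\setminus\bigcup_{G\in\mathcal{G}}\operatorname{Int}(G),$$ so that $\operatorname{Int}(K)\subset T\subset K\setminus X$. Then there is a map $f:\mathbb{R}^n\to\mathbb{R}^n$ with polynomial components such that $f(T)=T\setminus F$. -/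

import Mathlib

namespace PolyhedronImage

/-- A convex polyhedron: a finite intersection of closed half-spaces `{h ≥ 0}`, where each `h` is a
non-constant affine function. The empty intersection, the whole space, is allowed. -/
def IsConvexPolyhedron {n : ℕ} (K : Set (EuclideanSpace ℝ (Fin n))) : Prop :=
  ∃ (m : ℕ) (h : Fin m → (EuclideanSpace ℝ (Fin n) →ᵃ[ℝ] ℝ)),
    (∀ i, (h i).linear ≠ 0) ∧ K = {x | ∀ i, 0 ≤ h i x}

/-- The dimension of a set: the dimension of the smallest affine subspace that contains it. -/
noncomputable def affineDim {n : ℕ} (S : Set (EuclideanSpace ℝ (Fin n))) : ℕ :=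
  Module.finrank ℝ (affineSpan ℝ S).direction

/-- The recession cone: the vectors `v` such that the rays with direction `v` that start in `K` stay
in `K`. (If `K` is a non-empty convex polyhedron, then one starting point decides.) -/
def recessionCone {n : ℕ} (K : Set (EuclideanSpace ℝ (Fin n))) :
    Set (EuclideanSpace ℝ (Fin n)) :=
  {v | ∀ p ∈ K, ∀ t : ℝ, 0 ≤ t → p + t • v ∈ K}

/-- `F` is a facet of the polyhedron `K`: inside the affine subspace `A` spanned by `K`, the set `K`
is cut out by a minimal family of half-spaces `{h i ≥ 0}` (each `h i` is non-constant on `A`, and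
no member of the family can be left out), and `F` is the intersection of `K` with one of the
hyperplanes `{h i = 0}`. The minimal family is unique up to positive factors and order. -/
def IsFacet {n : ℕ} (K F : Set (EuclideanSpace ℝ (Fin n))) : Prop :=
  ∃ (m : ℕ) (h : Fin m → (EuclideanSpace ℝ (Fin n) →ᵃ[ℝ] ℝ)),
    (∀ i, ∃ x ∈ affineSpan ℝ K, ∃ y ∈ affineSpan ℝ K, h i x ≠ h i y) ∧
    K = {x | x ∈ affineSpan ℝ K ∧ ∀ i, 0 ≤ h i x} ∧
    (∀ i, K ≠ {x | x ∈ affineSpan ℝ K ∧ ∀ j, j ≠ i → 0 ≤ h j x}) ∧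
    ∃ i, F = K ∩ {x | h i x = 0}

/-- The union of the affine subspaces spanned by the faces of `K` of codimension two; these faces
are the facets of the facets of `K`. -/
def codimTwoUnion {n : ℕ} (K : Set (EuclideanSpace ℝ (Fin n))) :
    Set (EuclideanSpace ℝ (Fin n)) :=
  {x | ∃ G E, IsFacet K G ∧ IsFacet G E ∧ x ∈ affineSpan ℝ E}

/-- A polynomial map: every component is given by a polynomial in the coordinates. -/
def IsPolynomialMap {n : ℕ} (f : EuclideanSpace ℝ (Fin n) → EuclideanSpace ℝ (Fin n)) : Prop :=
  ∃ P : Fin n → MvPolynomial (Fin n) ℝ, ∀ x i, f x i = MvPolynomial.eval (fun j => x j) (P i)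

end PolyhedronImage

set_option linter.unusedSectionVars false

namespace PolyhedronImage

/-! Choose `w ≠ 0` parallel to a ray in `F`, and `v` along which every wall function increases. It
suffices to find a polynomial map that fixes the other walls pointwise and sends the interior
together with the relative interior of `F` onto the interior: points of `T` on other walls stay put,
and the corners of `F` were removed with `X`.

A push along `v` moves `F` inside (`exists_push`), but may lose interior points close to `F`. By
`exists_push_wall`, a point can be lost only if the product `tau` of the wall functions constant
along `w` is small there, and the point is neither far out along `w` nor very close to a wall
transversal to `w`.

The gaps are filled by contractions along `w`, one for each transversal wall (`exists_contraction`).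
On a line ending at the wall `h k = 0`, a far point, which is not lost, is brought back close to
that end; since remote points move outwards, continuity covers everything beyond its image. The
contraction replaces `h k` by `h k * (1 - θ)^2 + θ^2 * (Θ^2 + σ)`, which is positive, and tiny when
`θ = 1` and `Θ`, `σ` are tiny.

The danger is a line where another `h c` is smaller than `h k`: there the point could leave through
`h c = 0`. Hence `Θ` is an iterated fold. It is large where some `h c` is clearly below `h k`, and
`σ` handles slight differences (`exists_pos_add_shift`); where `h k` is smallest it has a zero far
out, so that `θ = 1` occurs with `Θ` tiny (`exists_far_small`). If no wall is transversal to `w`, an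
odd polynomial in one variable does the job (`exists_map_of_isEmpty`). -/

/-- A real function given by a polynomial in the coordinates. -/
def IsPolynomialFun {n : ℕ} (g : EuclideanSpace ℝ (Fin n) → ℝ) : Prop :=
  ∃ p : MvPolynomial (Fin n) ℝ, ∀ x, g x = MvPolynomial.eval (fun j => x j) p

/-! ### Closure properties of polynomial functions and maps -/

namespace IsPolynomialFun

variable {n : ℕ} {g g' : EuclideanSpace ℝ (Fin n) → ℝ}

theorem const (c : ℝ) : IsPolynomialFun (fun _ : EuclideanSpace ℝ (Fin n) => c) :=
  ⟨MvPolynomial.C c, fun x => by simp⟩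

theorem coord (i : Fin n) : IsPolynomialFun (fun x : EuclideanSpace ℝ (Fin n) => x i) :=
  ⟨MvPolynomial.X i, fun x => by simp⟩

theorem add (hg : IsPolynomialFun g) (hg' : IsPolynomialFun g') :
    IsPolynomialFun (fun x => g x + g' x) := by
  obtain ⟨p, hp⟩ := hg
  obtain ⟨q, hq⟩ := hg'
  exact ⟨p + q, fun x => by simp [hp, hq]⟩

theorem mul (hg : IsPolynomialFun g) (hg' : IsPolynomialFun g') :
    IsPolynomialFun (fun x => g x * g' x) := by
  obtain ⟨p, hp⟩ := hg
  obtain ⟨q, hq⟩ := hg'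
  exact ⟨p * q, fun x => by simp [hp, hq]⟩

theorem sub (hg : IsPolynomialFun g) (hg' : IsPolynomialFun g') :
    IsPolynomialFun (fun x => g x - g' x) := by
  obtain ⟨p, hp⟩ := hg
  obtain ⟨q, hq⟩ := hg'
  exact ⟨p - q, fun x => by simp [hp, hq]⟩

theorem pow (hg : IsPolynomialFun g) (k : ℕ) : IsPolynomialFun (fun x => g x ^ k) := by
  obtain ⟨p, hp⟩ := hg
  exact ⟨p ^ k, fun x => by simp [hp]⟩

theorem sum {ι : Type*} (s : Finset ι) {g : ι → EuclideanSpace ℝ (Fin n) → ℝ}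
    (hg : ∀ i, IsPolynomialFun (g i)) : IsPolynomialFun (fun x => ∑ i ∈ s, g i x) := by
  choose p hp using hg
  exact ⟨∑ i ∈ s, p i, fun x => by simp [hp]⟩

theorem prod {ι : Type*} (s : Finset ι) {g : ι → EuclideanSpace ℝ (Fin n) → ℝ}
    (hg : ∀ i, IsPolynomialFun (g i)) : IsPolynomialFun (fun x => ∏ i ∈ s, g i x) := by
  choose p hp using hg
  exact ⟨∏ i ∈ s, p i, fun x => by simp [hp]⟩

theorem continuous (hg : IsPolynomialFun g) : Continuous g := by
  obtain ⟨p, hp⟩ := hg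
  have : g = fun x => MvPolynomial.eval (fun j => x j) p := funext hp
  rw [this]
  exact (MvPolynomial.continuous_eval p).comp (by fun_prop)

theorem affineMap (h : EuclideanSpace ℝ (Fin n) →ᵃ[ℝ] ℝ) : IsPolynomialFun (fun x => h x) := by
  have key : ∀ x, h x = (∑ i, x i * h.linear (EuclideanSpace.single i 1)) + h 0 := by
    intro x
    have h1 : h x = h.linear x + h 0 := by
      have := h.map_vadd 0 x
      simpa using this
    rw [h1]
    congr 1
    conv_lhs => rw [← (EuclideanSpace.basisFun (Fin n) ℝ).sum_repr x]
    simp [map_sum]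
  have := (IsPolynomialFun.sum (n := n) Finset.univ
    (fun i => (coord i).mul (const (h.linear (EuclideanSpace.single i 1))))).add (const (h 0))
  simpa only [← key] using this

end IsPolynomialFun

theorem IsPolynomialFun.comp {n : ℕ} {g : EuclideanSpace ℝ (Fin n) → ℝ}
    {f : EuclideanSpace ℝ (Fin n) → EuclideanSpace ℝ (Fin n)}
    (hg : IsPolynomialFun g) (hf : IsPolynomialMap f) : IsPolynomialFun (fun x => g (f x)) := by
  obtain ⟨p, hp⟩ := hg
  obtain ⟨P, hP⟩ := hf
  refine ⟨MvPolynomial.bind₁ P p, fun x => ?_⟩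
  show g (f x) = _
  rw [hp, ← MvPolynomial.coe_aeval_eq_eval, ← MvPolynomial.coe_aeval_eq_eval]
  simp only [RingHom.coe_coe]
  rw [MvPolynomial.aeval_bind₁]
  congr 2
  ext j
  rw [hP x j, ← MvPolynomial.coe_aeval_eq_eval]
  rfl

theorem isPolynomialMap_iff {n : ℕ} {f : EuclideanSpace ℝ (Fin n) → EuclideanSpace ℝ (Fin n)} :
    IsPolynomialMap f ↔ ∀ i, IsPolynomialFun (fun x => f x i) := by
  constructor
  · rintro ⟨P, hP⟩ i
    exact ⟨P i, fun x => hP x i⟩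
  · intro h
    choose P hP using h
    exact ⟨P, fun x i => hP i x⟩

theorem IsPolynomialMap.comp {n : ℕ} {f f' : EuclideanSpace ℝ (Fin n) → EuclideanSpace ℝ (Fin n)}
    (hf : IsPolynomialMap f) (hf' : IsPolynomialMap f') : IsPolynomialMap (f ∘ f') :=
  isPolynomialMap_iff.2 fun i => (isPolynomialMap_iff.1 hf i).comp hf'

theorem IsPolynomialMap.id {n : ℕ} :
    IsPolynomialMap (id : EuclideanSpace ℝ (Fin n) → EuclideanSpace ℝ (Fin n)) :=
  isPolynomialMap_iff.2 fun i => IsPolynomialFun.coord i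

theorem isPolynomialMap_add_smul {n : ℕ} {g : EuclideanSpace ℝ (Fin n) → ℝ}
    (hg : IsPolynomialFun g) (v : EuclideanSpace ℝ (Fin n)) :
    IsPolynomialMap (fun x => x + g x • v) :=
  isPolynomialMap_iff.2 fun i => by
    simpa using (IsPolynomialFun.coord i).add (hg.mul (IsPolynomialFun.const (v i)))

theorem affineMap_add_smul {n : ℕ} (h : EuclideanSpace ℝ (Fin n) →ᵃ[ℝ] ℝ)
    (x v : EuclideanSpace ℝ (Fin n)) (s : ℝ) : h (x + s • v) = h x + s * h.linear v := by
  have := h.map_vadd x (s • v)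
  simp only [vadd_eq_add, map_smul, smul_eq_mul] at this
  rw [add_comm x, this, add_comm]

end PolyhedronImage

/-! ### Pushing one wall into the interior -/

namespace PolyhedronImage

/-- The wall `h i₀ = 0` of the polyhedral set `{h ≥ 0}` is pushed into the interior along `v`; the
points that may get lost satisfy neither of the two conditions in the last clause. -/
theorem exists_push {n : ℕ} {ι : Type*} [Fintype ι] [DecidableEq ι]
    (h : ι → (EuclideanSpace ℝ (Fin n) →ᵃ[ℝ] ℝ)) (i₀ : ι) (v : EuclideanSpace ℝ (Fin n))
    (hv : ∀ i, 0 < (h i).linear v) {E : EuclideanSpace ℝ (Fin n) → ℝ} (hE : IsPolynomialFun E) :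
    ∃ f : EuclideanSpace ℝ (Fin n) → EuclideanSpace ℝ (Fin n), IsPolynomialMap f ∧
      (∀ x, ∀ i, i ≠ i₀ → h i x = 0 → f x = x) ∧
      (∀ x, (∀ i, i ≠ i₀ → 0 < h i x) → 0 ≤ h i₀ x → ∀ i, 0 < h i (f x)) ∧
      ∀ y, (∀ i, 0 < h i y) →
        ((∏ i ∈ Finset.univ.erase i₀, h i y ^ 2) * (h i₀).linear v ≤ h i₀ y ∨ 1 ≤ h i₀ y * E y) →
        ∃ x, (∀ i, i ≠ i₀ → 0 < h i x) ∧ 0 ≤ h i₀ x ∧ f x = y := by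
  set P : EuclideanSpace ℝ (Fin n) → ℝ := fun x => ∏ i ∈ Finset.univ.erase i₀, h i x ^ 2 with hP
  set q : EuclideanSpace ℝ (Fin n) → ℝ := fun x => (h i₀ x * E x - 1) ^ 2 with hq
  have hPpoly : IsPolynomialFun P :=
    IsPolynomialFun.prod _ fun i => (IsPolynomialFun.affineMap (h i)).pow 2
  have hqpoly : IsPolynomialFun q :=
    (((IsPolynomialFun.affineMap (h i₀)).mul hE).sub (IsPolynomialFun.const 1)).pow 2
  have hP0 : ∀ x, ∀ i, i ≠ i₀ → h i x = 0 → P x = 0 := fun x i hi hx =>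
    Finset.prod_eq_zero (Finset.mem_erase.2 ⟨hi, Finset.mem_univ i⟩) (by simp [hx])
  have hPnn : ∀ x, 0 ≤ P x := fun x => Finset.prod_nonneg fun i _ => sq_nonneg _
  have hqnn : ∀ x, 0 ≤ q x := fun x => sq_nonneg _
  refine ⟨fun x => x + (P x * q x) • v, isPolynomialMap_add_smul (hPpoly.mul hqpoly) v,
    fun x i hi hx => by simp [hP0 x i hi hx], fun x hx hx0 i => ?_, fun y hy hcase => ?_⟩
  · rw [affineMap_add_smul]
    have hnn : 0 ≤ P x * q x * (h i).linear v :=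
      mul_nonneg (mul_nonneg (hPnn x) (hqnn x)) (hv i).le
    by_cases hi : i = i₀
    · subst hi
      rcases hx0.eq_or_lt with h0 | h0
      · have hq1 : q x = 1 := by simp [hq, ← h0]
        have hP1 : 0 < P x := Finset.prod_pos fun j hj =>
          pow_pos (hx j (Finset.ne_of_mem_erase hj)) 2
        rw [← h0, hq1]
        have := mul_pos hP1 (hv i)
        linarith
      · linarith
    · linarith [hx i hi]
  -- The preimage is sought as `y - s • v`, a zero of `F` below. Going back along `-v`, the line
  -- first meets a wall at `s = L`, namely wall `j`.
  · obtain ⟨j, -, hj⟩ := Finset.exists_min_image Finset.univ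
      (fun i => h i y / (h i).linear v) ⟨i₀, Finset.mem_univ i₀⟩
    set L := h j y / (h j).linear v with hL
    have hLpos : 0 < L := div_pos (hy j) (hv j)
    have hγ : ∀ i, ∀ s, h i (y + (-s) • v) = h i y - s * (h i).linear v := fun i s => by
      rw [affineMap_add_smul]; ring
    have hγnn : ∀ i, ∀ s, s ≤ L → 0 ≤ h i (y + (-s) • v) := fun i s hs => by
      rw [hγ]
      have := (le_div_iff₀ (hv i)).1 (hs.trans (hj i (Finset.mem_univ i)))
      linarith
    have hγL : h j (y + (-L) • v) = 0 := by
      rw [hγ, hL, div_mul_cancel₀ _ (hv j).ne', sub_self]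
    set F : ℝ → ℝ := fun s => -s + P (y + (-s) • v) * q (y + (-s) • v) with hF
    have hFc : Continuous F := by
      have h1 : Continuous fun s : ℝ => y + (-s) • v := by fun_prop
      exact continuous_neg.add ((hPpoly.continuous.comp h1).mul (hqpoly.continuous.comp h1))
    have hF0 : 0 ≤ F 0 := by
      have := mul_nonneg (hPnn y) (hqnn y)
      simpa [hF] using this
    -- If `j ≠ i₀`, then `P` vanishes at `L`. If `j = i₀`, then either `q = 1` and `P ≤ L` at the
    -- exit, or `h i₀ * E` passes through `1` on the way, where `q = 0`.
    obtain ⟨s₁, hs₁0, hs₁L, hs₁⟩ : ∃ s₁, 0 ≤ s₁ ∧ s₁ ≤ L ∧ F s₁ ≤ 0 := by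
      by_cases hji : j = i₀
      · rcases hcase with hc | hc
        · refine ⟨L, hLpos.le, le_rfl, ?_⟩
          have h0 : h i₀ (y + (-L) • v) = 0 := hji ▸ hγL
          have hq1 : q (y + (-L) • v) = 1 := by simp only [hq, h0]; norm_num
          have hPle : P (y + (-L) • v) ≤ P y := by
            refine Finset.prod_le_prod (fun i _ => sq_nonneg _) fun i _ => ?_
            refine pow_le_pow_left₀ (hγnn i L le_rfl) ?_ 2
            rw [hγ]
            linarith [mul_pos hLpos (hv i)]
          have hPL : P y ≤ L := by
            rw [hL, hji]
            exact (le_div_iff₀ (hv i₀)).2 hc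
          show -L + P _ * q _ ≤ 0
          rw [hq1]
          linarith
        · have hc' : Continuous fun s : ℝ => h i₀ (y + (-s) • v) * E (y + (-s) • v) := by
            have h1 : Continuous fun s : ℝ => y + (-s) • v := by fun_prop
            exact ((IsPolynomialFun.affineMap (h i₀)).continuous.comp h1).mul
              (hE.continuous.comp h1)
          have hmem : (1 : ℝ) ∈ Set.Icc (h i₀ (y + (-L) • v) * E (y + (-L) • v))
              (h i₀ (y + (-0 : ℝ) • v) * E (y + (-0 : ℝ) • v)) := by
            constructor
            · rw [← hji, hγL]; simp
            · simpa using hc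
          obtain ⟨s, ⟨hs0, hsL⟩, hs⟩ := intermediate_value_Icc' hLpos.le hc'.continuousOn hmem
          refine ⟨s, hs0, hsL, ?_⟩
          have hq0 : q (y + (-s) • v) = 0 := by
            simp only [hq]
            simp only at hs
            rw [hs]; ring
          show -s + P _ * q _ ≤ 0
          rw [hq0]
          linarith
      · refine ⟨L, hLpos.le, le_rfl, ?_⟩
        show -L + P _ * q _ ≤ 0
        rw [hP0 _ j hji hγL]
        linarith
    obtain ⟨s, ⟨hs0, hss₁⟩, hs⟩ := intermediate_value_Icc' hs₁0 hFc.continuousOn ⟨hs₁, hF0⟩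
    have hs' : P (y + (-s) • v) * q (y + (-s) • v) = s := by
      have : -s + P (y + (-s) • v) * q (y + (-s) • v) = 0 := hs
      linarith
    refine ⟨y + (-s) • v, fun i hi => ?_, hγnn i₀ s (hss₁.trans hs₁L), ?_⟩
    -- On another wall `P = 0` forces `s = 0`, but `y` lies on no wall.
    · refine (hγnn i s (hss₁.trans hs₁L)).lt_of_ne fun h0 => ?_
      have hP0' := hP0 _ i hi h0.symm
      rw [hP0', zero_mul] at hs'
      rw [← hs'] at h0
      simp only [neg_zero, zero_smul, add_zero] at h0
      exact (hy i).ne h0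
    · show y + (-s) • v + (P _ * q _) • v = y
      rw [hs']
      module

/-! ### Coordinates and bounds along an unbounded direction -/

/-- A polyhedral set `{g ≥ 0, h ≥ 0}` with a direction `w` along which the functions `g` are constant
and the functions `h` grow with slope one; `ell` is an affine coordinate along `w`. -/
structure Prism (n : ℕ) (α β : Type) where
  g : α → (EuclideanSpace ℝ (Fin n) →ᵃ[ℝ] ℝ)
  h : β → (EuclideanSpace ℝ (Fin n) →ᵃ[ℝ] ℝ)
  ell : EuclideanSpace ℝ (Fin n) →ᵃ[ℝ] ℝ
  w : EuclideanSpace ℝ (Fin n)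
  g_w : ∀ a, (g a).linear w = 0
  h_w : ∀ b, (h b).linear w = 1
  ell_w : ell.linear w = 1

namespace Prism

variable {n : ℕ} {α β : Type} [Fintype α] [Fintype β] (D : Prism n α β)

/-- The interior of the polyhedral set. -/
def inside : Set (EuclideanSpace ℝ (Fin n)) := {x | (∀ a, 0 < D.g a x) ∧ ∀ b, 0 < D.h b x}

/-- The product of the functions that are constant along `w`. -/
noncomputable def tau (x : EuclideanSpace ℝ (Fin n)) : ℝ := ∏ a, D.g a x

/-- The squared product of the functions that grow along `w`. -/
noncomputable def rho (x : EuclideanSpace ℝ (Fin n)) : ℝ := ∏ b, D.h b x ^ 2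

/-- A bound for the data that are constant along `w`. -/
noncomputable def width (x : EuclideanSpace ℝ (Fin n)) : ℝ :=
  2 + ∑ a, D.g a x ^ 2 + ∑ b, (D.h b x - D.ell x) ^ 2

/-- A bound for all the data. -/
noncomputable def size (x : EuclideanSpace ℝ (Fin n)) : ℝ := D.width x + D.ell x ^ 2

theorem isPolynomialFun_tau : IsPolynomialFun D.tau :=
  IsPolynomialFun.prod _ fun a => IsPolynomialFun.affineMap (D.g a)

theorem isPolynomialFun_rho : IsPolynomialFun D.rho :=
  IsPolynomialFun.prod _ fun b => (IsPolynomialFun.affineMap (D.h b)).pow 2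

theorem isPolynomialFun_width : IsPolynomialFun D.width :=
  ((IsPolynomialFun.const 2).add
    (IsPolynomialFun.sum _ fun a => (IsPolynomialFun.affineMap (D.g a)).pow 2)).add
    (IsPolynomialFun.sum _ fun b =>
      ((IsPolynomialFun.affineMap (D.h b)).sub (IsPolynomialFun.affineMap D.ell)).pow 2)

theorem isPolynomialFun_size : IsPolynomialFun D.size :=
  D.isPolynomialFun_width.add ((IsPolynomialFun.affineMap D.ell).pow 2)

section Line

variable (x : EuclideanSpace ℝ (Fin n)) (s : ℝ)

@[simp] theorem g_line (a : α) : D.g a (x + s • D.w) = D.g a x := by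
  rw [affineMap_add_smul, D.g_w]; ring

@[simp] theorem h_line (b : β) : D.h b (x + s • D.w) = D.h b x + s := by
  rw [affineMap_add_smul, D.h_w]; ring

@[simp] theorem ell_line : D.ell (x + s • D.w) = D.ell x + s := by
  rw [affineMap_add_smul, D.ell_w]; ring

@[simp] theorem tau_line : D.tau (x + s • D.w) = D.tau x := by simp [tau]

@[simp] theorem width_line : D.width (x + s • D.w) = D.width x := by simp [width]

end Line

section Bounds

variable {x : EuclideanSpace ℝ (Fin n)}

theorem two_le_width (x : EuclideanSpace ℝ (Fin n)) : 2 ≤ D.width x := by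
  have h1 : 0 ≤ ∑ a, D.g a x ^ 2 := Finset.sum_nonneg fun _ _ => sq_nonneg _
  have h2 : 0 ≤ ∑ b, (D.h b x - D.ell x) ^ 2 := Finset.sum_nonneg fun _ _ => sq_nonneg _
  unfold width
  linarith

theorem width_le_size (x : EuclideanSpace ℝ (Fin n)) : D.width x ≤ D.size x := by
  unfold size
  linarith [sq_nonneg (D.ell x)]

theorem two_le_size (x : EuclideanSpace ℝ (Fin n)) : 2 ≤ D.size x :=
  (D.two_le_width x).trans (D.width_le_size x)

theorem g_sq_le (a : α) : 2 + D.g a x ^ 2 ≤ D.width x := by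
  have h1 : D.g a x ^ 2 ≤ ∑ a, D.g a x ^ 2 :=
    Finset.single_le_sum (f := fun a => D.g a x ^ 2) (fun _ _ => sq_nonneg _) (Finset.mem_univ a)
  have h2 : 0 ≤ ∑ b, (D.h b x - D.ell x) ^ 2 := Finset.sum_nonneg fun _ _ => sq_nonneg _
  unfold width
  linarith

theorem h_sub_sq_le (b : β) : 2 + (D.h b x - D.ell x) ^ 2 ≤ D.width x := by
  have h1 : (D.h b x - D.ell x) ^ 2 ≤ ∑ b, (D.h b x - D.ell x) ^ 2 :=
    Finset.single_le_sum (f := fun b => (D.h b x - D.ell x) ^ 2) (fun _ _ => sq_nonneg _)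
      (Finset.mem_univ b)
  have h2 : 0 ≤ ∑ a, D.g a x ^ 2 := Finset.sum_nonneg fun _ _ => sq_nonneg _
  unfold width
  linarith

theorem abs_h_sub_ell_le (b : β) : |D.h b x - D.ell x| ≤ D.width x / 2 := by
  have := D.h_sub_sq_le (x := x) b
  rw [abs_le]
  constructor <;> nlinarith [sq_nonneg (D.h b x - D.ell x - 1), sq_nonneg (D.h b x - D.ell x + 1)]

theorem abs_h_sub_h_le (b c : β) : |D.h b x - D.h c x| ≤ D.width x / 2 := by
  by_cases hbc : b = c
  · subst hbc
    simp
    linarith [D.two_le_width x]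
  have h1 : (D.h b x - D.ell x) ^ 2 + (D.h c x - D.ell x) ^ 2 ≤ ∑ b, (D.h b x - D.ell x) ^ 2 := by
    classical
    rw [← Finset.sum_pair (f := fun b => (D.h b x - D.ell x) ^ 2) hbc]
    exact Finset.sum_le_sum_of_subset_of_nonneg (Finset.subset_univ _) fun _ _ _ => sq_nonneg _
  have h2 : 0 ≤ ∑ a, D.g a x ^ 2 := Finset.sum_nonneg fun _ _ => sq_nonneg _
  have h3 : 2 + (D.h b x - D.ell x) ^ 2 + (D.h c x - D.ell x) ^ 2 ≤ D.width x := by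
    unfold width; linarith
  rw [abs_le]
  constructor <;>
    nlinarith [sq_nonneg (D.h b x - D.ell x - 1), sq_nonneg (D.h b x - D.ell x + 1),
      sq_nonneg (D.h c x - D.ell x - 1), sq_nonneg (D.h c x - D.ell x + 1)]

theorem g_le_width (a : α) : D.g a x ≤ D.width x := by
  nlinarith [D.g_sq_le (x := x) a, sq_nonneg (D.g a x - 1)]

theorem h_le_size (b : β) : D.h b x ≤ D.size x := by
  have := D.h_sub_sq_le (x := x) b
  unfold size
  nlinarith [sq_nonneg (D.h b x - D.ell x - 1), sq_nonneg (D.ell x - 1)]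

theorem tau_pos (hx : x ∈ D.inside) : 0 < D.tau x := Finset.prod_pos fun a _ => hx.1 a

theorem rho_pos (hx : x ∈ D.inside) : 0 < D.rho x :=
  Finset.prod_pos fun b _ => pow_pos (hx.2 b) 2

theorem tau_le (hx : x ∈ D.inside) : D.tau x ≤ D.width x ^ Fintype.card α := by
  refine (Finset.prod_le_prod (fun a _ => (hx.1 a).le) fun a _ => D.g_le_width a).trans_eq ?_
  simp

theorem rho_le_of_bound (hx : x ∈ D.inside) {M : ℝ} (hM : 1 ≤ M) (hb : ∀ b, D.h b x ≤ M) (b : β) :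
    D.rho x ≤ D.h b x ^ 2 * M ^ (2 * Fintype.card β) := by
  classical
  unfold rho
  rw [← Finset.mul_prod_erase _ _ (Finset.mem_univ b)]
  refine mul_le_mul_of_nonneg_left ?_ (sq_nonneg _)
  calc ∏ c ∈ Finset.univ.erase b, D.h c x ^ 2 ≤ ∏ _c ∈ Finset.univ.erase b, M ^ 2 :=
        Finset.prod_le_prod (fun c _ => sq_nonneg _)
          fun c _ => pow_le_pow_left₀ (hx.2 c).le (hb c) 2
    _ = M ^ (2 * (Finset.univ.erase b).card) := by rw [Finset.prod_const, ← pow_mul]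
    _ ≤ M ^ (2 * Fintype.card β) :=
        pow_le_pow_right₀ hM (Nat.mul_le_mul_left 2 (Finset.card_le_univ _))

end Bounds

end Prism

end PolyhedronImage

/-! ### Scalar inequalities for the contraction -/

namespace PolyhedronImage

/-- AM-GM gives `2 * u * θ ≤ h / 4 + θ^2 * Θ^2`. Here and in the next three lemmas `u`, `h` stand
for the values of `h k`, `h c`, and the long expression is `h c` after the contraction towards `h k
= 0`. -/
theorem half_le_of_fold_large {u h θ Θ σ : ℝ} (hh : 0 < h) (hu : 0 ≤ u) (hσ : 0 ≤ σ)
    (hΘ : 4 * u ^ 2 ≤ Θ ^ 2 * h) :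
    h / 2 ≤ h + (-2 * u * θ + u * θ ^ 2 + θ ^ 2 * (Θ ^ 2 + σ)) := by
  have h1 : 2 * u * θ ≤ h / 4 + θ ^ 2 * Θ ^ 2 := by
    refine le_of_sq_le_sq ?_ (by positivity)
    nlinarith [mul_le_mul_of_nonneg_left hΘ (sq_nonneg θ), sq_nonneg (h / 4 - θ ^ 2 * Θ ^ 2)]
  have h2 : 0 ≤ u * θ ^ 2 := by positivity
  have h3 : 0 ≤ θ ^ 2 * σ := by positivity
  nlinarith

/-- The two bounds combine to `2 * u * θ ≤ h / 2` for `θ = r * Θ`; all other terms are non-negative.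
-/
theorem half_le_of_theta_small {u h r Θ σ : ℝ} (hh : 0 < h) (hu : 0 ≤ u) (hσ : 0 ≤ σ)
    (hΘ : Θ ^ 2 * h ≤ 4 * u ^ 2) (hr : 64 * u ^ 4 * r ^ 2 ≤ h ^ 3) :
    h / 2 ≤ h + (-2 * u * (r * Θ) + u * (r * Θ) ^ 2 + (r * Θ) ^ 2 * (Θ ^ 2 + σ)) := by
  have h1 : 2 * u * (r * Θ) ≤ h / 2 := by
    refine le_of_sq_le_sq ?_ (by positivity)
    have e1 : (2 * u * (r * Θ)) ^ 2 * h ≤ (h / 2) ^ 2 * h := by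
      nlinarith [mul_le_mul_of_nonneg_left hΘ (show 0 ≤ 4 * u ^ 2 * r ^ 2 by positivity)]
    exact le_of_mul_le_mul_right e1 hh
  have h2 : 0 ≤ u * (r * Θ) ^ 2 := by positivity
  have h3 : 0 ≤ (r * Θ) ^ 2 * (Θ ^ 2 + σ) := by positivity
  linarith

/-- Complete the square in `θ`: without the term `θ^2 * Θ^2` the minimum is `h - u^2 / (u + σ)`, and
`hgap` says exactly that this is positive. -/
theorem pos_of_gap_small {u h θ Θ σ : ℝ} (hh : 0 < h) (hσ : 0 < σ) (hu : h < u)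
    (hgap : (u - h) ^ 2 < h * (σ - (u - h))) :
    0 < h + (-2 * u * θ + u * θ ^ 2 + θ ^ 2 * (Θ ^ 2 + σ)) := by
  have hu0 : 0 < u := hh.trans hu
  have h1 : 0 < (u + σ) * (h + (-2 * u * θ + u * θ ^ 2 + θ ^ 2 * σ)) := by
    have e : (u + σ) * (h + (-2 * u * θ + u * θ ^ 2 + θ ^ 2 * σ)) =
        (h * (σ - (u - h)) - (u - h) ^ 2) + ((u + σ) * θ - u) ^ 2 := by ring
    rw [e]
    nlinarith [sq_nonneg ((u + σ) * θ - u)]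
  have h2 := (pos_iff_pos_of_mul_pos h1).1 (by positivity : 0 < u + σ)
  have h3 : 0 ≤ θ ^ 2 * Θ ^ 2 := by positivity
  linarith

theorem pos_of_le {u h θ Θ σ : ℝ} (hh : 0 < h) (hσ : 0 < σ) (hu : 0 < u) (huh : u ≤ h) :
    0 < h + (-2 * u * θ + u * θ ^ 2 + θ ^ 2 * (Θ ^ 2 + σ)) := by
  have e : h + (-2 * u * θ + u * θ ^ 2 + θ ^ 2 * (Θ ^ 2 + σ)) =
      (h - u) + u * (1 - θ) ^ 2 + θ ^ 2 * Θ ^ 2 + θ ^ 2 * σ := by ring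
  rw [e]
  by_cases h0 : θ = 0
  · subst h0
    simp
    linarith
  · have : 0 < θ ^ 2 * σ := by positivity
    have : 0 ≤ u * (1 - θ) ^ 2 := by positivity
    have : 0 ≤ θ ^ 2 * Θ ^ 2 := by positivity
    linarith

/-- If `h`, `σ` are bounded below by an inverse power of a large number, and `ε` by a much smaller
one, then `ε` is small enough for `pos_of_gap_small`. -/
theorem gap_lt {h σ ε X : ℝ} (hX : 1 ≤ X) (hh : 1 ≤ h * X) (hσ : 1 ≤ σ * X) (hε : 0 < ε)
    (hεX : 16 * ε ^ 2 * X ^ 4 ≤ 1) : ε ^ 2 < h * (σ - ε) := by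
  have hX0 : 0 < X := by linarith
  have h1 : 4 * ε * X ^ 2 ≤ 1 := by
    refine le_of_sq_le_sq ?_ zero_le_one
    calc (4 * ε * X ^ 2) ^ 2 = 16 * ε ^ 2 * X ^ 4 := by ring
      _ ≤ 1 ^ 2 := by linarith
  have h2 : 4 * ε * X ≤ 1 := by nlinarith [mul_pos hε hX0]
  have h3 : 3 / 4 ≤ (σ - ε) * X := by nlinarith
  have h4 : 3 / 4 ≤ (h * (σ - ε)) * X ^ 2 := by
    have : 1 * (3 / 4) ≤ (h * X) * ((σ - ε) * X) := by
      apply mul_le_mul hh h3 (by norm_num) (by linarith)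
    nlinarith
  have h5 : ε ^ 2 * X ^ 2 ≤ 1 / 16 := by
    have : (4 * ε * X) ^ 2 ≤ 1 := by
      apply pow_le_one₀ (by positivity) h2
    nlinarith
  have h6 : ε ^ 2 * X ^ 2 < (h * (σ - ε)) * X ^ 2 := by linarith
  exact lt_of_mul_lt_mul_right h6 (by positivity)

/-! ### Iterated folds and positivity of the contraction -/

namespace Prism

variable {n : ℕ} {α β : Type} [Fintype α] [Fintype β] (D : Prism n α β)

/-- The iterated folding map: on lines where some `h c` is smaller than `h k` it is large, on the other
lines it vanishes somewhere far away. -/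
noncomputable def chain (k : β) (b N : ℕ) : List β → EuclideanSpace ℝ (Fin n) → ℝ
  | [], x => (D.tau x ^ b * D.ell x - 1) ^ 2
  | c :: L, x => D.size x ^ N * (chain k b N L x - (D.h c x - D.h k x)) ^ 2

/-- The order of the list is immaterial below: what counts is that each `c` is treated. -/
noncomputable def fold (k : β) (b N : ℕ) (x : EuclideanSpace ℝ (Fin n)) : ℝ :=
  D.chain k b N Finset.univ.toList x

/-- The factors `rho` and `tau ^ e` make the contraction fix all walls when `e ≠ 0`; inside they are
positive, so only `fold` produces zeros. -/
noncomputable def theta (k : β) (e b N : ℕ) (x : EuclideanSpace ℝ (Fin n)) : ℝ :=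
  D.rho x * D.tau x ^ e * D.fold k b N x

/-- The amount by which the contraction towards the wall `h k = 0` moves a point along `w`. -/
noncomputable def shift (k : β) (e a b N : ℕ) (x : EuclideanSpace ℝ (Fin n)) : ℝ :=
  -2 * D.h k x * D.theta k e b N x + D.h k x * D.theta k e b N x ^ 2 +
    D.theta k e b N x ^ 2 * (D.fold k b N x ^ 2 + D.tau x ^ a)

variable (k : β) (e a b N : ℕ)

theorem isPolynomialFun_chain (L : List β) : IsPolynomialFun (D.chain k b N L) := by
  induction L with
  | nil =>
    exact (((D.isPolynomialFun_tau.pow b).mul (IsPolynomialFun.affineMap D.ell)).sub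
      (IsPolynomialFun.const 1)).pow 2
  | cons c L ih =>
    exact (D.isPolynomialFun_size.pow N).mul ((ih.sub ((IsPolynomialFun.affineMap (D.h c)).sub
      (IsPolynomialFun.affineMap (D.h k)))).pow 2)

theorem isPolynomialFun_theta : IsPolynomialFun (D.theta k e b N) :=
  (D.isPolynomialFun_rho.mul (D.isPolynomialFun_tau.pow e)).mul (D.isPolynomialFun_chain k b N _)

theorem isPolynomialFun_shift : IsPolynomialFun (D.shift k e a b N) := by
  have h1 := D.isPolynomialFun_theta k e b N
  have h2 := IsPolynomialFun.affineMap (D.h k)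
  have h3 : IsPolynomialFun (D.fold k b N) := D.isPolynomialFun_chain k b N _
  exact ((((IsPolynomialFun.const (-2)).mul h2).mul h1).add (h2.mul (h1.pow 2))).add
    ((h1.pow 2).mul ((h3.pow 2).add (D.isPolynomialFun_tau.pow a)))

theorem chain_nonneg (L : List β) (x : EuclideanSpace ℝ (Fin n)) : 0 ≤ D.chain k b N L x := by
  have := D.two_le_size x
  cases L with
  | nil => exact sq_nonneg _
  | cons c L => exact mul_nonneg (by positivity) (sq_nonneg _)

variable {N} in
theorem four_le_size_pow (hN : 2 ≤ N) (x : EuclideanSpace ℝ (Fin n)) : 4 ≤ D.size x ^ N := by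
  have h := D.two_le_size x
  calc (4 : ℝ) = 2 ^ 2 := by norm_num
    _ ≤ D.size x ^ 2 := pow_le_pow_left₀ (by norm_num) h 2
    _ ≤ D.size x ^ N := pow_le_pow_right₀ (by linarith) hN

variable {k b N}

/-- As `|h c - h k| ≤ width / 2`, the subtraction leaves at least `W / 2`, and `size ^ N ≥ 4` turns
its square into at least `W^2 ≥ W`. -/
theorem le_chain_cons (hN : 2 ≤ N) {x : EuclideanSpace ℝ (Fin n)} {W : ℝ} (hW : D.width x ≤ W)
    (c : β) {L : List β} (hL : W ≤ D.chain k b N L x) : W ≤ D.chain k b N (c :: L) x := by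
  have hK := D.four_le_size_pow hN x
  have hz := (abs_le.1 (D.abs_h_sub_h_le (x := x) c k)).2
  have h2 := D.two_le_width x
  have h3 : W / 2 ≤ D.chain k b N L x - (D.h c x - D.h k x) := by linarith
  have h4 : (W / 2) ^ 2 ≤ (D.chain k b N L x - (D.h c x - D.h k x)) ^ 2 :=
    pow_le_pow_left₀ (by linarith) h3 2
  show W ≤ D.size x ^ N * (D.chain k b N L x - (D.h c x - D.h k x)) ^ 2
  nlinarith

theorem le_chain_of_le_nil (hN : 2 ≤ N) {x : EuclideanSpace ℝ (Fin n)}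
    (h0 : D.width x ≤ D.chain k b N [] x) (L : List β) : D.width x ≤ D.chain k b N L x := by
  induction L with
  | nil => exact h0
  | cons c L ih => exact D.le_chain_cons hN le_rfl c ih

/-- The step for `c` squares the sum of a non-negative chain and `h k - h c > 0`; by `le_chain_cons`
the remaining steps preserve the bound. -/
theorem le_chain_of_mem (hN : 2 ≤ N) {x : EuclideanSpace ℝ (Fin n)} {c : β}
    (hc : D.h c x < D.h k x)
    (hW : D.width x ≤ D.size x ^ N * (D.h k x - D.h c x) ^ 2) {L : List β} (hL : c ∈ L) :
    D.size x ^ N * (D.h k x - D.h c x) ^ 2 ≤ D.chain k b N L x := by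
  induction L with
  | nil => simp at hL
  | cons c' L ih =>
    rcases List.mem_cons.1 hL with rfl | hL
    · have h1 := D.chain_nonneg k b N L x
      have hK := D.four_le_size_pow hN x
      refine mul_le_mul_of_nonneg_left (pow_le_pow_left₀ (by linarith) (by linarith) 2)
        (by linarith)
    · exact D.le_chain_cons hN hW c' (ih hL)

/-- The key positivity: the contraction towards the wall `h k = 0` crosses none of the walls. -/
theorem exists_pos_add_shift (k : β) (e a₀ : ℕ) : ∃ N, 2 ≤ N ∧ ∀ b, ∀ x ∈ D.inside, ∀ c,
    0 < D.h c x + D.shift k e (2 * e * a₀) b N x := by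
  set m := Fintype.card α + Fintype.card β with hm
  set C₁ := 14 + 4 * m + 2 * e * m with hC₁
  set C := C₁ * (a₀ + 1) with hC
  -- `C₁` will bound `Θ^2`, `4 * C` pays for `X^4` in `gap_lt` with `X = Z ^ C`, and the last `4`
  -- absorbs the constant `16`.
  refine ⟨C₁ + 4 * C + 4, by omega, fun b x hx c => ?_⟩
  set N := C₁ + 4 * C + 4 with hN
  set Z := D.size x with hZ
  have hZ2 : 2 ≤ Z := D.two_le_size x
  have hZ1 : 1 ≤ Z := by linarith
  have hZ0 : 0 < Z := by linarith
  have hτ := D.tau_pos hx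
  have hρ := D.rho_pos hx
  have hτZ : D.tau x ≤ Z ^ m := by
    refine (D.tau_le hx).trans ?_
    calc D.width x ^ Fintype.card α ≤ Z ^ Fintype.card α :=
          pow_le_pow_left₀ (by linarith [D.two_le_width x]) (D.width_le_size x) _
      _ ≤ Z ^ m := pow_le_pow_right₀ hZ1 (by omega)
  set h := D.h c x with hh
  set u := D.h k x with hu
  have hh0 : 0 < h := hx.2 c
  have hu0 : 0 < u := hx.2 k
  have hhZ : h ≤ Z := D.h_le_size c
  have huZ : u ≤ Z := D.h_le_size k
  have hρZ : D.rho x ≤ h ^ 2 * Z ^ (2 * m) :=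
    (D.rho_le_of_bound hx hZ1 (fun b => D.h_le_size b) c).trans
      (mul_le_mul_of_nonneg_left (pow_le_pow_right₀ hZ1 (by omega)) (sq_nonneg _))
  set Θ := D.fold k b N x with hΘ
  set σ := D.tau x ^ (2 * e * a₀) with hσ
  have hσ0 : 0 < σ := by positivity
  set r := D.rho x * D.tau x ^ e with hr
  show 0 < h + (-2 * u * (r * Θ) + u * (r * Θ) ^ 2 + (r * Θ) ^ 2 * (Θ ^ 2 + σ))
  rcases le_or_gt u h with huh | huh
  · exact pos_of_le hh0 hσ0 hu0 huh
  rcases le_or_gt (4 * u ^ 2) (Θ ^ 2 * h) with h1 | h1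
  · linarith [half_le_of_fold_large (θ := r * Θ) hh0 hu0.le hσ0.le h1]
  rcases le_or_gt (64 * u ^ 4 * r ^ 2) (h ^ 3) with h2 | h2
  · linarith [half_le_of_theta_small hh0 hu0.le hσ0.le h1.le h2]
  -- Now `r` is not small compared with `h`. Since `r` is bounded by `h^2 * tau^e` times a power of
  -- `Z`, both `h` and `tau` are bounded below by inverse powers of `Z`.
  refine pos_of_gap_small hh0 hσ0 huh ?_
  set T := D.tau x ^ (2 * e) with hT
  have hT0 : 0 < T := by positivity
  have hr2 : r ^ 2 ≤ h ^ 4 * Z ^ (4 * m) * T := by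
    calc r ^ 2 = D.rho x ^ 2 * T := by rw [hr, hT, mul_pow, ← pow_mul, mul_comm e 2]
      _ ≤ (h ^ 2 * Z ^ (2 * m)) ^ 2 * T :=
          mul_le_mul_of_nonneg_right (pow_le_pow_left₀ hρ.le hρZ 2) hT0.le
      _ = h ^ 4 * Z ^ (4 * m) * T := by ring
  have hstar : 1 < Z ^ (10 + 4 * m) * T * h := by
    have e1 : 64 * u ^ 4 ≤ Z ^ 10 := by
      have e2 : (64 : ℝ) ≤ Z ^ 6 := by
        calc (64 : ℝ) = 2 ^ 6 := by norm_num
          _ ≤ Z ^ 6 := pow_le_pow_left₀ (by norm_num) hZ2 6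
      calc 64 * u ^ 4 ≤ Z ^ 6 * Z ^ 4 :=
            mul_le_mul e2 (pow_le_pow_left₀ hu0.le huZ 4) (by positivity) (by positivity)
        _ = Z ^ 10 := by ring
    have e3 : h ^ 3 * 1 < h ^ 3 * (Z ^ (10 + 4 * m) * T * h) := by
      calc h ^ 3 * 1 < 64 * u ^ 4 * r ^ 2 := by linarith
        _ ≤ Z ^ 10 * (h ^ 4 * Z ^ (4 * m) * T) :=
            mul_le_mul e1 hr2 (sq_nonneg _) (by positivity)
        _ = h ^ 3 * (Z ^ (10 + 4 * m) * T * h) := by ring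
    exact lt_of_mul_lt_mul_left e3 (by positivity)
  have hTZ : T ≤ Z ^ (2 * e * m) := by
    calc T ≤ (Z ^ m) ^ (2 * e) := pow_le_pow_left₀ hτ.le hτZ _
      _ = Z ^ (2 * e * m) := by rw [← pow_mul]; ring_nf
  have hΘ2 : Θ ^ 2 ≤ Z ^ C₁ := by
    calc Θ ^ 2 ≤ Θ ^ 2 * (Z ^ (10 + 4 * m) * T * h) := le_mul_of_one_le_right (sq_nonneg _) hstar.le
      _ = (Θ ^ 2 * h) * (Z ^ (10 + 4 * m) * T) := by ring
      _ ≤ (4 * u ^ 2) * (Z ^ (10 + 4 * m) * T) :=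
          mul_le_mul_of_nonneg_right h1.le (by positivity)
      _ ≤ Z ^ 4 * (Z ^ (10 + 4 * m) * Z ^ (2 * e * m)) := by
          refine mul_le_mul ?_ (mul_le_mul_of_nonneg_left hTZ (by positivity)) (by positivity)
            (by positivity)
          nlinarith [pow_le_pow_left₀ hu0.le huZ 2, pow_le_pow_left₀ (by norm_num) hZ2 2,
            sq_nonneg Z]
      _ = Z ^ C₁ := by rw [hC₁]; ring
  have hTlow : 1 ≤ T * Z ^ (11 + 4 * m) := by
    calc 1 ≤ Z ^ (10 + 4 * m) * T * h := hstar.le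
      _ ≤ Z ^ (10 + 4 * m) * T * Z := mul_le_mul_of_nonneg_left hhZ (by positivity)
      _ = T * Z ^ (11 + 4 * m) := by ring
  have hC1le : C₁ ≤ C := Nat.le_mul_of_pos_right _ (by omega)
  have hX : 1 ≤ Z ^ C := one_le_pow₀ hZ1
  have hhX : 1 ≤ h * Z ^ C := by
    calc 1 ≤ Z ^ (10 + 4 * m) * T * h := hstar.le
      _ ≤ Z ^ (10 + 4 * m) * Z ^ (2 * e * m) * h := by gcongr
      _ = h * Z ^ (10 + 4 * m + 2 * e * m) := by ring
      _ ≤ h * Z ^ C := by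
          refine mul_le_mul_of_nonneg_left (pow_le_pow_right₀ hZ1 ?_) hh0.le
          omega
  -- `σ` is the `a₀`-th power of `T`, so it inherits the lower bound.
  have hσX : 1 ≤ σ * Z ^ C := by
    calc 1 ≤ (T * Z ^ (11 + 4 * m)) ^ a₀ := one_le_pow₀ hTlow
      _ = σ * Z ^ ((11 + 4 * m) * a₀) := by rw [mul_pow, hT, ← pow_mul, ← pow_mul, hσ]
      _ ≤ σ * Z ^ C := by
          refine mul_le_mul_of_nonneg_left (pow_le_pow_right₀ hZ1 ?_) hσ0.le
          rw [hC]
          exact Nat.mul_le_mul (by omega) (by omega)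
  have hε : 0 < u - h := by linarith
  refine gap_lt hX hhX hσX hε ?_
  -- A larger gap would make the fold exceed `Z ^ C₁`, against `hΘ2`.
  have hKε : Z ^ N * (u - h) ^ 2 ≤ Z ^ C₁ := by
    by_contra hcon
    push Not at hcon
    have hW : D.width x ≤ Z ^ N * (u - h) ^ 2 := by
      calc D.width x ≤ Z := D.width_le_size x
        _ = Z ^ 1 := (pow_one Z).symm
        _ ≤ Z ^ C₁ := pow_le_pow_right₀ hZ1 (by omega)
        _ ≤ _ := hcon.le
    have h3 : Z ^ N * (u - h) ^ 2 ≤ Θ :=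
      D.le_chain_of_mem (by omega) huh hW (by simp)
    have h4 : Z ^ C₁ < Θ := hcon.trans_le h3
    have h5 : 1 ≤ Z ^ C₁ := one_le_pow₀ hZ1
    nlinarith
  have hZpow : Z ^ N = Z ^ C₁ * ((Z ^ C) ^ 4 * Z ^ 4) := by
    rw [hN, ← pow_mul]; ring
  have h16 : (16 : ℝ) ≤ Z ^ 4 := by
    calc (16 : ℝ) = 2 ^ 4 := by norm_num
      _ ≤ Z ^ 4 := pow_le_pow_left₀ (by norm_num) hZ2 4
  have hfin : Z ^ C₁ * (16 * (u - h) ^ 2 * (Z ^ C) ^ 4) ≤ Z ^ C₁ * 1 := by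
    calc Z ^ C₁ * (16 * (u - h) ^ 2 * (Z ^ C) ^ 4)
        ≤ Z ^ C₁ * (Z ^ 4 * (u - h) ^ 2 * (Z ^ C) ^ 4) := by gcongr
      _ = Z ^ N * (u - h) ^ 2 := by rw [hZpow]; ring
      _ ≤ Z ^ C₁ * 1 := by linarith
  exact le_of_mul_le_mul_left hfin (by positivity)

end Prism

end PolyhedronImage

/-! ### The contraction on lines parallel to `w` -/

namespace PolyhedronImage

namespace Prism

variable {n : ℕ} {α β : Type} [Fintype α] [Fintype β] (D : Prism n α β)

theorem shift_eq_zero {k : β} {e a b N : ℕ} (he : e ≠ 0) {x : EuclideanSpace ℝ (Fin n)}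
    (hx : D.tau x = 0 ∨ D.rho x = 0) : D.shift k e a b N x = 0 := by
  have : D.theta k e b N x = 0 := by
    unfold theta
    rcases hx with h | h <;> simp [h, he]
  simp [shift, this]

theorem rho_eq_zero {x : EuclideanSpace ℝ (Fin n)} {c : β} (h : D.h c x = 0) : D.rho x = 0 :=
  Finset.prod_eq_zero (Finset.mem_univ c) (by simp [h])

theorem h_sq_le_rho {x : EuclideanSpace ℝ (Fin n)} (k : β) (h1 : ∀ c, 1 ≤ D.h c x) :
    D.h k x ^ 2 ≤ D.rho x := by
  classical
  unfold rho
  rw [← Finset.mul_prod_erase _ _ (Finset.mem_univ k)]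
  refine le_mul_of_one_le_right (sq_nonneg _) ?_
  calc (1 : ℝ) = ∏ _c ∈ Finset.univ.erase k, (1 : ℝ) := by simp
    _ ≤ _ := Finset.prod_le_prod (fun _ _ => zero_le_one) fun c _ => one_le_pow₀ (h1 c)

/-- Far away on a line, the contraction moves points outwards. -/
theorem eventually_far (k : β) (e b : ℕ) {N : ℕ} (hN : 2 ≤ N) {y : EuclideanSpace ℝ (Fin n)}
    (hy : y ∈ D.inside) : ∀ᶠ s : ℝ in Filter.atTop,
      y + s • D.w ∈ D.inside ∧ (∀ L, D.width y ≤ D.chain k b N L (y + s • D.w)) ∧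
      2 ≤ D.theta k e b N (y + s • D.w) := by
  have hτ := D.tau_pos hy
  have hall : ∀ᶠ s : ℝ in Filter.atTop, ∀ c, 1 - D.h c y ≤ s :=
    Filter.eventually_all.2 fun c => Filter.eventually_ge_atTop _
  filter_upwards [hall, Filter.eventually_ge_atTop (1 / D.tau y ^ e + 1 - D.h k y),
    Filter.eventually_ge_atTop ((D.width y + 1) / D.tau y ^ b - D.ell y)] with s h1 h2 h3
  have hY := D.two_le_width y
  have hh1 : ∀ c, 1 ≤ D.h c (y + s • D.w) := fun c => by
    rw [h_line]; linarith [h1 c]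
  have hin : y + s • D.w ∈ D.inside :=
    ⟨fun a => by rw [g_line]; exact hy.1 a, fun c => by linarith [hh1 c]⟩
  have hch : ∀ L, D.width y ≤ D.chain k b N L (y + s • D.w) := by
    intro L
    have := D.le_chain_of_le_nil (k := k) (b := b) hN (x := y + s • D.w) ?_ L
    · simpa using this
    · show D.width _ ≤ (D.tau _ ^ b * D.ell _ - 1) ^ 2
      rw [width_line, tau_line, ell_line]
      have h4 : D.width y + 1 ≤ D.tau y ^ b * (D.ell y + s) := by
        have := (div_le_iff₀ (by positivity : 0 < D.tau y ^ b)).1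
          (by linarith : (D.width y + 1) / D.tau y ^ b ≤ D.ell y + s)
        linarith
      nlinarith
  refine ⟨hin, hch, ?_⟩
  have hr : 1 ≤ D.rho (y + s • D.w) * D.tau (y + s • D.w) ^ e := by
    have h5 := D.h_sq_le_rho k hh1
    have h6 : 1 / D.tau y ^ e ≤ D.h k (y + s • D.w) := by rw [h_line]; linarith
    have h7 : D.h k (y + s • D.w) ≤ D.rho (y + s • D.w) := by nlinarith [hh1 k]
    rw [tau_line]
    exact (div_le_iff₀ (by positivity)).1 (h6.trans h7)
  have h8 : 2 ≤ D.fold k b N (y + s • D.w) := hY.trans (hch _)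
  unfold theta
  nlinarith

theorem shift_nonneg_of_two_le_theta {k : β} {e a b N : ℕ} {x : EuclideanSpace ℝ (Fin n)}
    (hx : x ∈ D.inside) (h : 2 ≤ D.theta k e b N x) : 0 ≤ D.shift k e a b N x := by
  have hu := hx.2 k
  have hτ := D.tau_pos hx
  have h1 : 0 ≤ D.theta k e b N x ^ 2 * (D.fold k b N x ^ 2 + D.tau x ^ a) := by positivity
  have h2 : 0 ≤ D.h k x * D.theta k e b N x * (D.theta k e b N x - 2) :=
    mul_nonneg (mul_nonneg hu.le (by linarith)) (by linarith)
  unfold shift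
  nlinarith

theorem continuous_line_shift (k : β) (e a b N : ℕ) (y : EuclideanSpace ℝ (Fin n)) :
    Continuous fun s : ℝ => s + D.shift k e a b N (y + s • D.w) := by
  have h1 : Continuous fun s : ℝ => y + s • D.w := by fun_prop
  exact continuous_id.add ((D.isPolynomialFun_shift k e a b N).continuous.comp h1)

theorem exists_line_shift_eq_zero (k : β) (e a b : ℕ) {N : ℕ} (hN : 2 ≤ N)
    {y : EuclideanSpace ℝ (Fin n)} (hy : y ∈ D.inside) {s₀ : ℝ}
    (hs₀ : s₀ + D.shift k e a b N (y + s₀ • D.w) ≤ 0) :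
    ∃ s, s₀ ≤ s ∧ s + D.shift k e a b N (y + s • D.w) = 0 := by
  obtain ⟨q, hq, hq0, hqs⟩ := ((D.eventually_far k e b hN hy).and
    ((Filter.eventually_ge_atTop 0).and (Filter.eventually_ge_atTop s₀))).exists
  have h1 := D.shift_nonneg_of_two_le_theta (a := a) hq.1 hq.2.2
  obtain ⟨s, hs, hs'⟩ := intermediate_value_Icc hqs
    (D.continuous_line_shift k e a b N y).continuousOn
    (show (0 : ℝ) ∈ Set.Icc _ _ from ⟨hs₀, by linarith⟩)
  exact ⟨s, hs.1, hs'⟩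

/-- Close to the walls, the contraction reduces the distance at most by half. -/
theorem half_le_add_shift (k : β) {a b N e : ℕ} {x : EuclideanSpace ℝ (Fin n)} (hx : x ∈ D.inside)
    (he : e = 5 + 2 * (Fintype.card α + Fintype.card β))
    (hτ : D.tau x * D.width x < 1) (c : β) (hc : D.h c x ≤ 1) :
    D.h c x / 2 ≤ D.h c x + D.shift k e a b N x := by
  set m := Fintype.card α + Fintype.card β with hm
  have hY := D.two_le_width x
  set Y := D.width x with hYdef
  have hτ0 := D.tau_pos hx
  have hρ := D.rho_pos hx
  have hbd : ∀ b, D.h b x ≤ Y := fun b => by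
    have := (abs_le.1 (D.abs_h_sub_h_le (x := x) b c)).2
    linarith
  set h := D.h c x with hh
  set u := D.h k x with hu
  have hh0 : 0 < h := hx.2 c
  have hu0 : 0 < u := hx.2 k
  have hρY : D.rho x ≤ h ^ 2 * Y ^ (2 * m) :=
    (D.rho_le_of_bound hx (by linarith) hbd c).trans
      (mul_le_mul_of_nonneg_left (pow_le_pow_right₀ (by linarith) (by omega)) (sq_nonneg _))
  set Θ := D.fold k b N x with hΘ
  have hσ0 : 0 < D.tau x ^ a := by positivity
  set r := D.rho x * D.tau x ^ e with hr
  show h / 2 ≤ h + (-2 * u * (r * Θ) + u * (r * Θ) ^ 2 + (r * Θ) ^ 2 * (Θ ^ 2 + D.tau x ^ a))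
  rcases le_or_gt (4 * u ^ 2) (Θ ^ 2 * h) with h1 | h1
  · exact half_le_of_fold_large hh0 hu0.le hσ0.le h1
  refine half_le_of_theta_small hh0 hu0.le hσ0.le h1.le ?_
  have e1 : 64 * u ^ 4 ≤ Y ^ 10 := by
    have e2 : (64 : ℝ) ≤ Y ^ 6 := by
      calc (64 : ℝ) = 2 ^ 6 := by norm_num
        _ ≤ Y ^ 6 := pow_le_pow_left₀ (by norm_num) hY 6
    calc 64 * u ^ 4 ≤ Y ^ 6 * Y ^ 4 :=
          mul_le_mul e2 (pow_le_pow_left₀ hu0.le (hbd k) 4) (by positivity) (by positivity)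
      _ = Y ^ 10 := by ring
  -- `2 * e = 10 + 4 * m` matches the powers of `Y` coming from `64 * u^4` and `rho^2`; they are
  -- absorbed by `tau * Y < 1`.
  have hr2 : r ^ 2 ≤ h ^ 4 * Y ^ (4 * m) * D.tau x ^ (10 + 4 * m) := by
    calc r ^ 2 = D.rho x ^ 2 * D.tau x ^ (10 + 4 * m) := by
          rw [hr, mul_pow, ← pow_mul]; congr 2; omega
      _ ≤ (h ^ 2 * Y ^ (2 * m)) ^ 2 * D.tau x ^ (10 + 4 * m) :=
          mul_le_mul_of_nonneg_right (pow_le_pow_left₀ hρ.le hρY 2) (by positivity)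
      _ = _ := by ring
  calc 64 * u ^ 4 * r ^ 2 ≤ Y ^ 10 * (h ^ 4 * Y ^ (4 * m) * D.tau x ^ (10 + 4 * m)) :=
        mul_le_mul e1 hr2 (sq_nonneg _) (by positivity)
    _ = h ^ 4 * (D.tau x * Y) ^ (10 + 4 * m) := by rw [mul_pow]; ring
    _ ≤ h ^ 4 * 1 :=
        mul_le_mul_of_nonneg_left (pow_le_one₀ (by positivity) hτ.le) (by positivity)
    _ ≤ h ^ 3 := by nlinarith [pow_pos hh0 3]

theorem exists_chain_le (k : β) (b N : ℕ) (L : List β) : ∃ p, ∀ x ∈ D.inside, D.tau x ≤ 1 →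
    D.chain k b N L x ≤ D.size x ^ p := by
  induction L with
  | nil =>
    refine ⟨2, fun x hx hτ => ?_⟩
    have h0 := D.tau_pos hx
    have h1 : D.tau x ^ b ≤ 1 := pow_le_one₀ h0.le hτ
    have h2 : 0 < D.tau x ^ b := by positivity
    have h3 : |D.tau x ^ b * D.ell x| ≤ |D.ell x| := by
      rw [abs_mul, abs_of_pos h2]
      exact mul_le_of_le_one_left (abs_nonneg _) h1
    have h4 : |D.ell x| + 1 ≤ D.size x := by
      have := D.two_le_width x
      unfold size
      nlinarith [sq_abs (D.ell x), sq_nonneg (|D.ell x| - 1)]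
    refine sq_le_sq' ?_ ?_ <;> linarith [abs_le.1 h3]
  | cons c L ih =>
    obtain ⟨p, hp⟩ := ih
    refine ⟨N + 2 * (p + 2), fun x hx hτ => ?_⟩
    have hZ := D.two_le_size x
    have hp' := hp x hx hτ
    have hnn := D.chain_nonneg k b N L x
    have hz := abs_le.1 (D.abs_h_sub_h_le (x := x) c k)
    have hYZ := D.width_le_size x
    have hZp : 1 ≤ D.size x ^ p := one_le_pow₀ (by linarith)
    have h1 : D.chain k b N L x + D.size x ≤ D.size x ^ (p + 2) := by
      have : D.size x ^ (p + 2) = D.size x ^ p * D.size x ^ 2 := by ring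
      rw [this]
      have h5 : 2 * D.size x ≤ D.size x ^ 2 := by nlinarith
      nlinarith
    show D.size x ^ N * (D.chain k b N L x - (D.h c x - D.h k x)) ^ 2 ≤ _
    rw [pow_add, pow_mul']
    refine mul_le_mul_of_nonneg_left (sq_le_sq' ?_ ?_) (by positivity) <;> linarith

/-- Bounds how far outwards a point at moderate distance can be carried, so that points still
farther out lie beyond its image. -/
theorem exists_shift_le (k : β) (e a b N : ℕ) : ∃ p, ∀ x ∈ D.inside, D.tau x ≤ 1 →
    D.shift k e a b N x ≤ D.size x ^ p := by
  obtain ⟨p, hp⟩ := D.exists_chain_le k b N Finset.univ.toList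
  set t := 2 + 2 * Fintype.card β + p with ht
  refine ⟨2 * t + 2 * p + 2, fun x hx hτ => ?_⟩
  have hZ := D.two_le_size x
  have hτ0 := D.tau_pos hx
  have hρ := D.rho_pos hx
  have hΘ0 : 0 ≤ D.fold k b N x := D.chain_nonneg k b N _ x
  have hΘ : D.fold k b N x ≤ D.size x ^ p := hp x hx hτ
  have hu := hx.2 k
  have huZ := D.h_le_size (x := x) k
  have hρZ : D.rho x ≤ D.size x ^ (2 + 2 * Fintype.card β) := by
    refine (D.rho_le_of_bound hx (by linarith) (fun b => D.h_le_size b) k).trans ?_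
    rw [pow_add]
    exact mul_le_mul_of_nonneg_right (pow_le_pow_left₀ hu.le huZ 2) (by positivity)
  have hθ0 : 0 ≤ D.theta k e b N x := by unfold theta; positivity
  have hθ : D.theta k e b N x ≤ D.size x ^ t := by
    have h1 : D.tau x ^ e ≤ 1 := pow_le_one₀ hτ0.le hτ
    calc D.theta k e b N x ≤ D.rho x * 1 * D.fold k b N x := by
          unfold theta; gcongr
      _ ≤ D.size x ^ (2 + 2 * Fintype.card β) * D.size x ^ p := by
          rw [mul_one]; gcongr
      _ = D.size x ^ t := by rw [ht, ← pow_add]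
  have hθ2 : D.theta k e b N x ^ 2 ≤ (D.size x ^ t) ^ 2 := pow_le_pow_left₀ hθ0 hθ 2
  have hΘ2 : D.fold k b N x ^ 2 ≤ (D.size x ^ p) ^ 2 := pow_le_pow_left₀ hΘ0 hΘ 2
  have hτa : D.tau x ^ a ≤ 1 := pow_le_one₀ hτ0.le hτ
  have hp1 : 1 ≤ D.size x ^ p := one_le_pow₀ (by linarith)
  have h3 : 0 ≤ D.h k x * D.theta k e b N x := by positivity
  calc D.shift k e a b N x
      ≤ D.h k x * D.theta k e b N x ^ 2 +
        D.theta k e b N x ^ 2 * (D.fold k b N x ^ 2 + D.tau x ^ a) := by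
        unfold shift; linarith
    _ = D.theta k e b N x ^ 2 * (D.h k x + D.fold k b N x ^ 2 + D.tau x ^ a) := by ring
    _ ≤ (D.size x ^ t) ^ 2 * (D.size x + (D.size x ^ p) ^ 2 + 1) := by gcongr
    _ ≤ (D.size x ^ t) ^ 2 * ((D.size x ^ p) ^ 2 * D.size x ^ 2) := by
        refine mul_le_mul_of_nonneg_left ?_ (by positivity)
        have h4 : 1 ≤ (D.size x ^ p) ^ 2 := one_le_pow₀ hp1
        nlinarith [mul_le_mul_of_nonneg_right h4 (by nlinarith : 0 ≤ D.size x ^ 2 - 1)]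
    _ = D.size x ^ (2 * t + 2 * p + 2) := by ring

/-- On a line where `h k` is the smallest of the functions `h c`, all iterated folding maps vanish
somewhere far away. -/
theorem exists_chain_eq_zero (k : β) {b N : ℕ} {y : EuclideanSpace ℝ (Fin n)}
    (hk : ∀ c, D.h k y ≤ D.h c y) {s₀ q : ℝ} (hsq : s₀ ≤ q)
    (h0 : D.chain k b N [] (y + s₀ • D.w) = 0)
    (hq : ∀ L, D.width y ≤ D.chain k b N L (y + q • D.w)) (L : List β) :
    ∃ p, s₀ ≤ p ∧ p ≤ q ∧ D.chain k b N L (y + p • D.w) = 0 := by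
  induction L with
  | nil => exact ⟨s₀, le_rfl, hsq, h0⟩
  | cons c L ih =>
    obtain ⟨p, hp0, hpq, hp⟩ := ih
    have hcont : Continuous fun s : ℝ => D.chain k b N L (y + s • D.w) := by
      have h1 : Continuous fun s : ℝ => y + s • D.w := by fun_prop
      exact (D.isPolynomialFun_chain k b N L).continuous.comp h1
    have hz := (abs_le.1 (D.abs_h_sub_h_le (x := y) c k)).2
    have hY := D.two_le_width y
    obtain ⟨r, hr, hr'⟩ := intermediate_value_Icc hpq hcont.continuousOn
      (show D.h c y - D.h k y ∈ Set.Icc _ _ from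
        ⟨by simp only [hp]; linarith [hk c], by linarith [hq L]⟩)
    refine ⟨r, hp0.trans hr.1, hr.2, ?_⟩
    show D.size _ ^ N * (D.chain k b N L _ - (D.h c _ - D.h k _)) ^ 2 = 0
    simp only at hr'
    rw [hr', h_line, h_line]
    ring

/-- On a line where `h k` is the smallest of the functions `h c`, points from far away are moved
close to the wall `h k = 0`. -/
theorem exists_far_small (k : β) {A a b e N : ℕ} (hN : 2 ≤ N) (ha : A + 2 ≤ a)
    (hb : b = a + e + 2) {y : EuclideanSpace ℝ (Fin n)} (hy : y ∈ D.inside)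
    (hτ : D.tau y * D.width y < 1) (hk : ∀ c, D.h k y ≤ D.h c y) :
    ∃ s, 1 ≤ D.tau y ^ b * (D.ell y + s) ∧
      D.h k y + s + D.shift k e a b N (y + s • D.w) ≤ D.tau y ^ A / 2 := by
  set t := D.tau y with ht
  have ht0 : 0 < t := D.tau_pos hy
  have hY := D.two_le_width y
  have ht2 : 2 * t ≤ 1 := by nlinarith
  have ht1 : t ≤ 1 := by linarith
  -- Here `ell = t^(-b)`, the zero of the innermost fold.
  set s₀ := 1 / t ^ b - D.ell y with hs₀
  have htb : 0 < t ^ b := by positivity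
  have h0 : D.chain k b N [] (y + s₀ • D.w) = 0 := by
    show (D.tau _ ^ b * D.ell _ - 1) ^ 2 = 0
    rw [tau_line, ell_line, ← ht, hs₀]
    field_simp
    ring
  obtain ⟨q, hq, hqs⟩ := ((D.eventually_far k e b hN hy).and
    (Filter.eventually_ge_atTop s₀)).exists
  obtain ⟨p, hp0, hpq, hp⟩ := D.exists_chain_eq_zero k hk hqs h0 hq.2.1 Finset.univ.toList
  have hcont : Continuous fun s : ℝ => D.theta k e b N (y + s • D.w) := by
    have h1 : Continuous fun s : ℝ => y + s • D.w := by fun_prop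
    exact (D.isPolynomialFun_theta k e b N).continuous.comp h1
  have hθp : D.theta k e b N (y + p • D.w) = 0 := by
    unfold theta fold
    rw [hp, mul_zero]
  -- `θ` goes from `0` to at least `2`. Where it equals `1`, the term `h k * (1 - θ)^2` drops out
  -- and only `Θ^2 + t^a` remains.
  obtain ⟨r, hr, hr'⟩ := intermediate_value_Icc hpq hcont.continuousOn
    (show (1 : ℝ) ∈ Set.Icc _ _ from
      ⟨by simp only [hθp]; norm_num, by linarith [hq.2.2]⟩)
  simp only at hr'
  have hrs : s₀ ≤ r := hp0.trans hr.1
  have hell : 1 / t ^ b ≤ D.ell y + r := by linarith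
  refine ⟨r, by have := (div_le_iff₀ htb).1 hell; linarith, ?_⟩
  set x := y + r • D.w with hx
  have hhx : ∀ c, t * (1 / t ^ b) ≤ D.h c x := fun c => by
    have h1 := (abs_le.1 (D.abs_h_sub_ell_le (x := y) c)).1
    have h2 : D.h c x = D.h c y + r := by rw [hx, h_line]
    have h3 : 1 / t ≤ 1 / t ^ b := by
      refine one_div_le_one_div_of_le htb ?_
      calc t ^ b ≤ t ^ 1 := pow_le_pow_of_le_one ht0.le ht1 (by omega)
        _ = t := pow_one t
    have h4 : D.width y ≤ 1 / t := by
      rw [le_div_iff₀ ht0]; linarith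
    have h5 : t * (1 / t ^ b) ≤ 1 / 2 * (1 / t ^ b) :=
      mul_le_mul_of_nonneg_right (by linarith) (by positivity)
    rw [h2]
    linarith
  have hone : 1 ≤ t * (1 / t ^ b) := by
    rw [mul_one_div, le_div_iff₀ htb, one_mul]
    calc t ^ b ≤ t ^ 1 := pow_le_pow_of_le_one ht0.le ht1 (by omega)
      _ = t := pow_one t
  have hρ : (t * (1 / t ^ b)) ^ 2 ≤ D.rho x :=
    (pow_le_pow_left₀ (by positivity) (hhx k) 2).trans
      (D.h_sq_le_rho k fun c => hone.trans (hhx c))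
  have hΘ0 : 0 ≤ D.fold k b N x := D.chain_nonneg k b N _ x
  have hτx : D.tau x = t := by rw [hx, tau_line]
  -- From `θ = 1`, `Θ = 1 / (rho * t^e) ≤ t^(2 * b - 2 - e)`; the choice of `b` makes this exponent
  -- `2 * a + e + 2`.
  have hΘ : D.fold k b N x ≤ t ^ a := by
    have h1 : D.rho x * t ^ e * D.fold k b N x = 1 := by
      rw [← hr']; unfold theta; rw [hτx]
    have h2 : (t * (1 / t ^ b)) ^ 2 * t ^ e * D.fold k b N x ≤ 1 := by
      refine le_of_le_of_eq ?_ h1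
      exact mul_le_mul_of_nonneg_right (mul_le_mul_of_nonneg_right hρ (by positivity)) hΘ0
    have h3 : t ^ (2 * b) * ((t * (1 / t ^ b)) ^ 2 * t ^ e) = t ^ (e + 2) := by
      field_simp
      ring
    have h4 : t ^ (e + 2) * D.fold k b N x ≤ t ^ (e + 2) * t ^ (2 * a + e + 2) := by
      calc t ^ (e + 2) * D.fold k b N x
          = t ^ (2 * b) * ((t * (1 / t ^ b)) ^ 2 * t ^ e * D.fold k b N x) := by rw [← h3]; ring
        _ ≤ t ^ (2 * b) * 1 := mul_le_mul_of_nonneg_left h2 (by positivity)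
        _ = t ^ (e + 2) * t ^ (2 * a + e + 2) := by rw [hb, mul_one, ← pow_add]; congr 1; ring
    exact (le_of_mul_le_mul_left h4 (by positivity)).trans
      (pow_le_pow_of_le_one ht0.le ht1 (by omega))
  have hta : t ^ a ≤ t ^ A / 4 := by
    calc t ^ a ≤ t ^ (A + 2) := pow_le_pow_of_le_one ht0.le ht1 ha
      _ = t ^ A * t ^ 2 := pow_add _ _ _
      _ ≤ t ^ A * (1 / 4) := mul_le_mul_of_nonneg_left (by nlinarith) (by positivity)
      _ = _ := by ring
  have hta1 : t ^ a ≤ 1 := pow_le_one₀ ht0.le ht1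
  have hΘ2 : D.fold k b N x ^ 2 ≤ t ^ a := by nlinarith
  have hfin : D.h k y + r + D.shift k e a b N x = D.fold k b N x ^ 2 + t ^ a := by
    have h2 : D.h k x = D.h k y + r := by rw [hx, h_line]
    unfold shift
    rw [hr', hτx, h2]
    ring
  rw [hfin]
  linarith

/-- A subset of the inside that contains a large part of it. -/
structure Covers (A : ℕ) (B : Set β) (S : Set (EuclideanSpace ℝ (Fin n))) : Prop where
  subset : S ⊆ D.inside
  mem : ∀ x ∈ D.inside, (1 ≤ D.tau x * D.width x ∨ 1 ≤ D.tau x ^ A * D.ell x ∨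
    (∃ c, D.h c x ≤ D.tau x ^ A) ∨ ∃ b ∈ B, ∀ c, D.h b x ≤ D.h c x) → x ∈ S

/-- Preimages come from the intermediate value theorem on the line through `y`. If the whole line
inside lies in `S`, its end and infinity serve as bounds. Otherwise only points near the end or far
out are available, and `A'` exceeds `A` to leave room for the distortion there. -/
theorem exists_contraction {A : ℕ} (hA : 1 ≤ A) (k : β) :
    ∃ (f : EuclideanSpace ℝ (Fin n) → EuclideanSpace ℝ (Fin n)) (A' : ℕ), 1 ≤ A' ∧
      IsPolynomialMap f ∧ (∀ x, D.tau x = 0 ∨ D.rho x = 0 → f x = x) ∧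
      ∀ B S, D.Covers A B S → D.Covers A' (insert k B) (f '' S) := by
  set e := 5 + 2 * (Fintype.card α + Fintype.card β) with he
  obtain ⟨N, hN, hpos⟩ := D.exists_pos_add_shift k e (A + 2)
  set a := 2 * e * (A + 2) with ha
  set b := a + e + 2 with hb
  have he0 : e ≠ 0 := by rw [he]; omega
  have haA : A + 2 ≤ a := Nat.le_mul_of_pos_left _ (by omega)
  obtain ⟨p, hp⟩ := D.exists_shift_le k e a b N
  set A' := A + (2 * A + 1) * p + 1 with hA'
  refine ⟨fun x => x + D.shift k e a b N x • D.w, A', by omega,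
    isPolynomialMap_add_smul (D.isPolynomialFun_shift k e a b N) D.w,
    fun x hx => by simp [D.shift_eq_zero he0 hx], fun B S hS => ⟨?_, ?_⟩⟩
  · rintro _ ⟨x, hx, rfl⟩
    have hx' := hS.subset hx
    exact ⟨fun c => by rw [g_line]; exact hx'.1 c, fun c => by rw [h_line]; exact hpos b x hx' c⟩
  intro y hy hcase
  obtain ⟨c, -, hc⟩ := Finset.exists_min_image Finset.univ (fun c => D.h c y) ⟨k, Finset.mem_univ k⟩
  have hc : ∀ c', D.h c y ≤ D.h c' y := fun c' => hc c' (Finset.mem_univ c')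
  have hd : 0 < D.h c y := hy.2 c
  have hin : ∀ s, - D.h c y < s → y + s • D.w ∈ D.inside := fun s hs =>
    ⟨fun a => by rw [g_line]; exact hy.1 a, fun c' => by rw [h_line]; linarith [hc c']⟩
  suffices ∃ s, y + s • D.w ∈ S ∧ s + D.shift k e a b N (y + s • D.w) = 0 by
    obtain ⟨s, hs, hs0⟩ := this
    refine ⟨_, hs, ?_⟩
    show y + s • D.w + D.shift k e a b N (y + s • D.w) • D.w = y
    rw [add_assoc, ← add_smul, hs0, zero_smul, add_zero]
  -- The line ends on the wall `h c = 0`, where `rho` kills the shift.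
  have hbot : - D.h c y + D.shift k e a b N (y + (-D.h c y) • D.w) = - D.h c y := by
    rw [D.shift_eq_zero he0 (Or.inr (D.rho_eq_zero (c := c) (by rw [h_line]; ring)))]
    ring
  have hfull : (∀ s, - D.h c y < s → y + s • D.w ∈ S) →
      ∃ s, y + s • D.w ∈ S ∧ s + D.shift k e a b N (y + s • D.w) = 0 := by
    intro hall
    obtain ⟨s, hs, hs0⟩ := D.exists_line_shift_eq_zero k e a b hN hy (s₀ := - D.h c y)
      (by rw [hbot]; linarith)
    refine ⟨s, hall s (hs.lt_of_ne fun h => ?_), hs0⟩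
    rw [← h, hbot] at hs0
    linarith
  by_cases hgap : 1 ≤ D.tau y * D.width y
  · exact hfull fun s hs => hS.mem _ (hin s hs) (Or.inl (by simpa using hgap))
  push Not at hgap
  set t := D.tau y with ht
  have ht0 : 0 < t := D.tau_pos hy
  have hY := D.two_le_width y
  have ht2 : 2 * t ≤ 1 := by nlinarith
  have ht1 : t ≤ 1 := by linarith
  have htA : 0 < t ^ A := by positivity
  have htA1 : t ^ A ≤ 1 := pow_le_one₀ ht0.le ht1
  -- The point with `h c = t^A` is sent to one with `h c ≥ t^A / 2`, not below `y`, so a preimage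
  -- exists between it and the end, where all points belong to `S`.
  have hnear : D.h c y ≤ t ^ A / 2 →
      ∃ s, y + s • D.w ∈ S ∧ s + D.shift k e a b N (y + s • D.w) = 0 := by
    intro hle
    set s₁ := - D.h c y + t ^ A with hs₁
    have h1 : D.h c (y + s₁ • D.w) = t ^ A := by rw [h_line]; ring
    have h2 := D.half_le_add_shift k (a := a) (b := b) (N := N) (hin s₁ (by linarith)) he
      (by simpa using hgap) c (by rw [h1]; exact htA1)
    rw [h1] at h2
    obtain ⟨s, hs, hs0⟩ := intermediate_value_Icc (show - D.h c y ≤ s₁ by linarith)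
      (D.continuous_line_shift k e a b N y).continuousOn
      (show (0 : ℝ) ∈ Set.Icc _ _ from ⟨by simp only [hbot]; linarith, by linarith⟩)
    simp only at hs0
    have hs' : - D.h c y < s := hs.1.lt_of_ne fun h => by
      rw [← h, hbot] at hs0
      linarith
    refine ⟨s, hS.mem _ (hin s hs') (Or.inr (Or.inr (Or.inl ⟨c, ?_⟩))), hs0⟩
    rw [h_line, tau_line]
    linarith [hs.2]
  -- Every point beyond `s₀` is still far out, hence in `S`; it is inside because there `ell >
  -- width`.
  have hfar : ∀ s₀, 1 ≤ t ^ A * (D.ell y + s₀) → s₀ + D.shift k e a b N (y + s₀ • D.w) ≤ 0 →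
      ∃ s, y + s • D.w ∈ S ∧ s + D.shift k e a b N (y + s • D.w) = 0 := by
    intro s₀ h1 h2
    obtain ⟨s, hs, hs0⟩ := D.exists_line_shift_eq_zero k e a b hN hy h2
    have h3 : 1 ≤ t ^ A * (D.ell y + s) :=
      h1.trans (mul_le_mul_of_nonneg_left (by linarith) htA.le)
    refine ⟨s, hS.mem _ (hin s ?_) (Or.inr (Or.inl (by rw [tau_line, ell_line]; exact h3))), hs0⟩
    have h4 := (abs_le.1 (D.abs_h_sub_ell_le (x := y) c)).1
    have h5 : t ^ A ≤ t := by
      calc t ^ A ≤ t ^ 1 := pow_le_pow_of_le_one ht0.le ht1 hA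
        _ = t := pow_one t
    have h6 : 0 < D.ell y + s := pos_of_mul_pos_right (by linarith) htA.le
    have h7 : 1 ≤ t * (D.ell y + s) := h3.trans (mul_le_mul_of_nonneg_right h5 h6.le)
    have h8 : D.width y < D.ell y + s := by
      have : t * D.width y < t * (D.ell y + s) := by linarith
      exact lt_of_mul_lt_mul_left this ht0.le
    linarith
  rcases hcase with h | h | ⟨c', h⟩ | ⟨b', hb', h⟩
  · linarith
  · set T := t⁻¹ with hT
    have htT : t * T = 1 := mul_inv_cancel₀ ht0.ne'
    have hT2 : 2 ≤ T := by
      rw [hT, le_inv_comm₀ (by norm_num) ht0]; linarith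
    have hYT : D.width y ≤ T := by
      have : t * D.width y < t * T := by linarith
      exact (lt_of_mul_lt_mul_left this ht0.le).le
    have htTp : ∀ j : ℕ, t ^ j * T ^ j = 1 := fun j => by rw [← mul_pow, htT, one_pow]
    -- Start where `ell = t^(-A)`: the image has `ell` at most `T^A + T^((2 * A + 1) * p) ≤ T^A'`,
    -- hence does not pass `y`.
    refine hfar (T ^ A - D.ell y) (by rw [add_sub_cancel, htTp]) ?_
    set s₂ := T ^ A - D.ell y with hs₂
    have hTA : T ≤ T ^ A := le_self_pow₀ (by linarith) (by omega)
    have hx : y + s₂ • D.w ∈ D.inside := by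
      refine hin s₂ ?_
      have h4 := (abs_le.1 (D.abs_h_sub_ell_le (x := y) c)).1
      linarith
    have h3 := hp _ hx (by rw [tau_line]; exact ht1)
    have h4 : D.size (y + s₂ • D.w) ≤ T ^ (2 * A + 1) := by
      have : D.size (y + s₂ • D.w) = D.width y + (T ^ A) ^ 2 := by
        unfold size
        rw [width_line, ell_line, hs₂, add_sub_cancel]
      rw [this, pow_succ T (2 * A), pow_mul' T 2 A]
      nlinarith
    have h5 : D.shift k e a b N (y + s₂ • D.w) ≤ T ^ ((2 * A + 1) * p) := by
      refine h3.trans ?_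
      rw [pow_mul]
      exact pow_le_pow_left₀ (by linarith [D.two_le_size (y + s₂ • D.w)]) h4 p
    have h6 : T ^ A' ≤ D.ell y := by
      have : t ^ A' * T ^ A' ≤ t ^ A' * D.ell y := by rw [htTp]; exact h
      exact le_of_mul_le_mul_left this (by positivity)
    have h7 : T ^ A + T ^ ((2 * A + 1) * p) ≤ T ^ A' := by
      have e1 : 1 ≤ T ^ A := one_le_pow₀ (by linarith)
      have e2 : 1 ≤ T ^ ((2 * A + 1) * p) := one_le_pow₀ (by linarith)
      rw [hA', pow_succ, pow_add]
      nlinarith [mul_nonneg (sub_nonneg.2 e1) (sub_nonneg.2 e2)]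
    linarith
  · refine hnear ((hc c').trans (h.trans ?_))
    calc t ^ A' ≤ t ^ (A + 1) := pow_le_pow_of_le_one ht0.le ht1 (by omega)
      _ = t ^ A * t := pow_succ _ _
      _ ≤ t ^ A * (1 / 2) := mul_le_mul_of_nonneg_left (by linarith) htA.le
      _ = _ := by ring
  · rcases Set.mem_insert_iff.1 hb' with rfl | hb'
    · rcases le_or_gt (D.h c y) (t ^ A / 2) with hle | hlt
      · exact hnear hle
      · obtain ⟨s, hs1, hs2⟩ := D.exists_far_small b' (A := A) (a := a) (b := b) (e := e) hN haA hb
          hy hgap h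
        refine hfar s ?_ ?_
        · have h6 : 0 < D.ell y + s := pos_of_mul_pos_right (one_pos.trans_le hs1)
            (pow_pos ht0 b).le
          exact hs1.trans (mul_le_mul_of_nonneg_right
            (pow_le_pow_of_le_one ht0.le ht1 (by omega)) h6.le)
        · linarith [hc b']
    · exact hfull fun s hs => hS.mem _ (hin s hs)
        (Or.inr (Or.inr (Or.inr ⟨b', hb', fun c' => by simpa using h c'⟩)))

end Prism

end PolyhedronImage

/-! ### Removing a wall -/

namespace PolyhedronImage

/-- For `r ≥ 0`, the expression vanishes at `t * s = 1` and is large beyond; oddness in `s` covers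
`r ≤ 0`. -/
theorem exists_mul_one_sub_sq_eq {t : ℝ} (ht : 0 < t) (r : ℝ) :
    ∃ s, 1 ≤ (t * s) ^ 2 ∧ s * (1 - (t * s) ^ 2) ^ 2 = r := by
  have key : ∀ r : ℝ, 0 ≤ r → ∃ s, 1 ≤ (t * s) ^ 2 ∧ s * (1 - (t * s) ^ 2) ^ 2 = r := by
    intro r hr
    have hc : Continuous fun s : ℝ => s * (1 - (t * s) ^ 2) ^ 2 := by fun_prop
    have h1 : t * (1 / t) = 1 := by field_simp
    have hle : 1 / t ≤ 2 / t + r := by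
      have : 1 / t ≤ 2 / t := div_le_div_of_nonneg_right (by norm_num) ht.le
      linarith
    have h2 : 2 ≤ t * (2 / t + r) := by
      have : t * (2 / t + r) = 2 + t * r := by field_simp
      rw [this]
      nlinarith [mul_nonneg ht.le hr]
    obtain ⟨s, hs, hs'⟩ := intermediate_value_Icc hle hc.continuousOn
      (show r ∈ Set.Icc _ _ from ⟨by simp only [h1]; norm_num; exact hr, by
        have h3 : 0 < 2 / t := by positivity
        have h4 : 1 ≤ (1 - (t * (2 / t + r)) ^ 2) ^ 2 := by
          have : 3 ≤ (t * (2 / t + r)) ^ 2 - 1 := by nlinarith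
          nlinarith
        have h5 : 0 ≤ 2 / t + r := by linarith
        calc r ≤ (2 / t + r) * 1 := by linarith
          _ ≤ _ := mul_le_mul_of_nonneg_left h4 h5⟩)
    refine ⟨s, ?_, hs'⟩
    have : 1 ≤ t * s := by
      rw [← h1]
      exact mul_le_mul_of_nonneg_left hs.1 ht.le
    exact one_le_pow₀ this
  rcases le_total 0 r with h | h
  · exact key r h
  · obtain ⟨s, hs, hs'⟩ := key (-r) (by linarith)
    refine ⟨-s, by simpa using hs, ?_⟩
    have : -s * (1 - (t * -s) ^ 2) ^ 2 = -(s * (1 - (t * s) ^ 2) ^ 2) := by ring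
    rw [this, hs', neg_neg]

namespace Prism

variable {n : ℕ} {α β : Type} [Fintype α] [Fintype β] (D : Prism n α β)

/-- The inside together with the relative interior of the wall `g a₀ = 0`. -/
def insideWithWall (a₀ : α) : Set (EuclideanSpace ℝ (Fin n)) :=
  {x | (∀ a, a ≠ a₀ → 0 < D.g a x) ∧ (∀ b, 0 < D.h b x) ∧ 0 ≤ D.g a₀ x}

/-- In `exists_push`, `E` is chosen so that `g a₀ * E = tau * size`. Close to a wall `h c = 0` the
other alternative applies, since the product there contains the small factor `(h c)^2`. -/
theorem exists_push_wall (a₀ : α) {v : EuclideanSpace ℝ (Fin n)}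
    (hvg : ∀ a, 0 < (D.g a).linear v) (hvh : ∀ b, 0 < (D.h b).linear v) :
    ∃ f : EuclideanSpace ℝ (Fin n) → EuclideanSpace ℝ (Fin n), IsPolynomialMap f ∧
      (∀ x, (∃ a, a ≠ a₀ ∧ D.g a x = 0) ∨ (∃ b, D.h b x = 0) → f x = x) ∧
      f '' D.insideWithWall a₀ ⊆ D.inside ∧
      ∀ y ∈ D.inside, (1 ≤ D.tau y * (D.width y + D.ell y ^ 2) ∨ (D.tau y * D.width y < 1 ∧
        ∃ c, D.h c y ≤ D.tau y ^ (3 * Fintype.card α + 2 * Fintype.card β + 1))) →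
        y ∈ f '' D.insideWithWall a₀ := by
  classical
  set E : EuclideanSpace ℝ (Fin n) → ℝ :=
    fun x => (∏ a ∈ Finset.univ.erase a₀, D.g a x) * (D.width x + D.ell x ^ 2) with hE
  have hEpoly : IsPolynomialFun E :=
    (IsPolynomialFun.prod _ fun a => IsPolynomialFun.affineMap (D.g a)).mul
      (D.isPolynomialFun_width.add ((IsPolynomialFun.affineMap D.ell).pow 2))
  have hτE : ∀ x, D.tau x = D.g a₀ x * ∏ a ∈ Finset.univ.erase a₀, D.g a x := fun x =>
    (Finset.mul_prod_erase _ (fun a => D.g a x) (Finset.mem_univ a₀)).symm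
  set c := (D.g a₀).linear v with hc
  have hc0 : 0 < c := hvg a₀
  -- Rescaling `v` gives `g a₀` slope one.
  obtain ⟨f, hf, hid, hin, hsurj⟩ := exists_push (Sum.elim D.g D.h) (Sum.inl a₀) (c⁻¹ • v)
    (by
      rintro (a | b)
      · simpa using mul_pos (inv_pos.2 hc0) (hvg a)
      · simpa using mul_pos (inv_pos.2 hc0) (hvh b)) hEpoly
  refine ⟨f, hf, ?_, ?_, fun y hy hcase => ?_⟩
  · rintro x (⟨a, ha, h0⟩ | ⟨b, h0⟩)
    · exact hid x (Sum.inl a) (by simpa using ha) h0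
    · exact hid x (Sum.inr b) (by simp) h0
  · rintro _ ⟨x, ⟨h1, h2, h3⟩, rfl⟩
    have := hin x (by
      rintro (a | b) hab
      · exact h1 a (by simpa using hab)
      · exact h2 b) h3
    exact ⟨fun a => this (Sum.inl a), fun b => this (Sum.inr b)⟩
  · obtain ⟨x, hx1, hx2, hx3⟩ := hsurj y (by
      rintro (a | b)
      · exact hy.1 a
      · exact hy.2 b) (by
      have hg0 := hy.1 a₀
      set π := ∏ a ∈ Finset.univ.erase a₀, D.g a y with hπ
      have hπ0 : 0 < π := Finset.prod_pos fun a _ => hy.1 a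
      rcases hcase with h | ⟨hτ, b, hb⟩
      · right
        show 1 ≤ D.g a₀ y * (π * (D.width y + D.ell y ^ 2))
        rw [← mul_assoc, ← hτE]
        exact h
      · left
        have h1 : (Sum.elim D.g D.h (Sum.inl a₀)).linear (c⁻¹ • v) = 1 := by
          show (D.g a₀).linear (c⁻¹ • v) = 1
          rw [map_smul, ← hc, smul_eq_mul, inv_mul_cancel₀ hc0.ne']
        rw [h1, mul_one]
        show _ ≤ D.g a₀ y
        have hP : ∏ i ∈ Finset.univ.erase (Sum.inl a₀), Sum.elim D.g D.h i y ^ 2 =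
            π ^ 2 * D.rho y := by
          have h2 := Finset.mul_prod_erase Finset.univ (fun i => Sum.elim D.g D.h i y ^ 2)
            (Finset.mem_univ (Sum.inl a₀))
          have h3 : ∏ i, Sum.elim D.g D.h i y ^ 2 = D.g a₀ y ^ 2 * (π ^ 2 * D.rho y) := by
            rw [Fintype.prod_sum_type]
            simp only [Sum.elim_inl, Sum.elim_inr]
            rw [Finset.prod_pow, ← mul_assoc, ← mul_pow, ← hτE]
            rfl
          rw [h3] at h2
          exact mul_left_cancel₀ (pow_pos hg0 2).ne' h2
        rw [hP]
        set t := D.tau y with ht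
        set Y := D.width y with hYdef
        have hY := D.two_le_width y
        have ht0 : 0 < t := D.tau_pos hy
        have ht1 : t ≤ 1 := by nlinarith
        have hb0 := hy.2 b
        have hpow1 : t ^ (3 * Fintype.card α + 2 * Fintype.card β + 1) ≤ 1 :=
          pow_le_one₀ ht0.le ht1
        have hbd : ∀ b', D.h b' y ≤ Y := fun b' => by
          have := (abs_le.1 (D.abs_h_sub_h_le (x := y) b' b)).2
          linarith
        have hρ := D.rho_le_of_bound hy (by linarith : 1 ≤ Y) hbd b
        have hπY : π ≤ Y ^ Fintype.card α := by
          calc π ≤ ∏ _a ∈ Finset.univ.erase a₀, Y :=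
                Finset.prod_le_prod (fun a _ => (hy.1 a).le) fun a _ => D.g_le_width a
            _ = Y ^ (Finset.univ.erase a₀).card := Finset.prod_const _
            _ ≤ Y ^ Fintype.card α :=
                pow_le_pow_right₀ (by linarith) (Finset.card_le_univ _)
        set κ := 3 * Fintype.card α + 2 * Fintype.card β with hκ
        -- The factor `π` turns `g a₀` into `t = tau`. Of the power `t^(2 * κ + 2)`, `t^κ` absorbs
        -- all powers of `Y` and a single `t` supplies the right-hand side.
        have hmain : π * (π ^ 2 * D.rho y) ≤ π * D.g a₀ y := by
          calc π * (π ^ 2 * D.rho y) = π ^ 3 * D.rho y := by ring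
            _ ≤ (Y ^ Fintype.card α) ^ 3 *
                ((t ^ (κ + 1)) ^ 2 * Y ^ (2 * Fintype.card β)) := by
                refine mul_le_mul (pow_le_pow_left₀ hπ0.le hπY 3) (hρ.trans ?_)
                  (D.rho_pos hy).le (by positivity)
                exact mul_le_mul_of_nonneg_right (pow_le_pow_left₀ hb0.le hb 2) (by positivity)
            _ = (t * Y) ^ κ * t ^ (κ + 1) * t := by
                rw [mul_pow, hκ]; ring
            _ ≤ 1 * 1 * t := by
                gcongr
                exact pow_le_one₀ (by positivity) hτ.le
            _ = π * D.g a₀ y := by rw [ht, hτE]; ring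
        exact le_of_mul_le_mul_left hmain hπ0)
    exact ⟨x, ⟨fun a ha => hx1 (Sum.inl a) (by simpa using ha), fun b => hx1 (Sum.inr b) (by simp),
      hx2⟩, hx3⟩

theorem exists_contractions {A : ℕ} (hA : 1 ≤ A) {S : Set (EuclideanSpace ℝ (Fin n))}
    (hS : D.Covers A ∅ S) (B : Finset β) :
    ∃ (f : EuclideanSpace ℝ (Fin n) → EuclideanSpace ℝ (Fin n)) (A' : ℕ), 1 ≤ A' ∧
      IsPolynomialMap f ∧ (∀ x, D.tau x = 0 ∨ D.rho x = 0 → f x = x) ∧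
      D.Covers A' B (f '' S) := by
  classical
  induction B using Finset.induction_on with
  | empty => exact ⟨id, A, hA, IsPolynomialMap.id, fun _ _ => rfl, by simpa using hS⟩
  | insert k B _ ih =>
    obtain ⟨f, A₁, hA₁, hf, hid, hcov⟩ := ih
    obtain ⟨f', A₂, hA₂, hf', hid', hcov'⟩ := D.exists_contraction hA₁ k
    refine ⟨f' ∘ f, A₂, hA₂, hf'.comp hf, fun x hx => ?_, ?_⟩
    · rw [Function.comp_apply, hid x hx, hid' x hx]
    · rw [Set.image_comp, Finset.coe_insert]
      exact hcov' _ _ hcov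

/-- Whole lines now lie inside. Their points with `(tau * ell)^2 ≥ 1` belong to `S`, and
`exists_mul_one_sub_sq_eq` maps them onto the line. -/
theorem exists_map_of_isEmpty [IsEmpty β] {S : Set (EuclideanSpace ℝ (Fin n))}
    (hsub : S ⊆ D.inside)
    (hS : ∀ y ∈ D.inside, 1 ≤ D.tau y * (D.width y + D.ell y ^ 2) → y ∈ S) :
    ∃ f : EuclideanSpace ℝ (Fin n) → EuclideanSpace ℝ (Fin n), IsPolynomialMap f ∧
      (∀ x, D.tau x = 0 ∨ D.rho x = 0 → f x = x) ∧ f '' S = D.inside := by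
  have hline : ∀ {y : EuclideanSpace ℝ (Fin n)}, y ∈ D.inside → ∀ s : ℝ, y + s • D.w ∈ D.inside :=
    fun hy s => ⟨fun a => by rw [g_line]; exact hy.1 a, fun b => isEmptyElim b⟩
  set G : EuclideanSpace ℝ (Fin n) → ℝ :=
    fun x => D.ell x * (1 - (D.tau x * D.ell x) ^ 2) ^ 2 - D.ell x with hG
  have hell := IsPolynomialFun.affineMap D.ell
  have hGpoly : IsPolynomialFun G :=
    (hell.mul (((IsPolynomialFun.const 1).sub
      ((D.isPolynomialFun_tau.mul hell).pow 2)).pow 2)).sub hell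
  refine ⟨fun x => x + G x • D.w, isPolynomialMap_add_smul hGpoly D.w, ?_, ?_⟩
  · rintro x (h | h)
    · simp [hG, h]
    · simp [rho] at h
  · apply Set.Subset.antisymm
    · rintro _ ⟨x, hx, rfl⟩
      exact hline (hsub hx) _
    · intro y hy
      have hτ := D.tau_pos hy
      have hY := D.two_le_width y
      obtain ⟨s, hs, hs'⟩ := exists_mul_one_sub_sq_eq hτ (D.ell y)
      refine ⟨y + (s - D.ell y) • D.w, hS _ (hline hy _) ?_, ?_⟩
      · rw [tau_line, width_line, ell_line, add_sub_cancel]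
        rcases le_total (D.tau y) 1 with h | h
        · nlinarith [sq_nonneg s, mul_nonneg hτ.le (sq_nonneg s)]
        · nlinarith [sq_nonneg s, mul_nonneg hτ.le (sq_nonneg s)]
      · have : G (y + (s - D.ell y) • D.w) = D.ell y - s := by
          simp only [hG, tau_line, ell_line, add_sub_cancel, hs']
        simp only [this]
        module

/-- The wall `g a₀ = 0` is removed by a polynomial map that fixes all the other walls. -/
theorem exists_map (a₀ : α) {v : EuclideanSpace ℝ (Fin n)}
    (hvg : ∀ a, 0 < (D.g a).linear v) (hvh : ∀ b, 0 < (D.h b).linear v) :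
    ∃ f : EuclideanSpace ℝ (Fin n) → EuclideanSpace ℝ (Fin n), IsPolynomialMap f ∧
      (∀ x, (∃ a, a ≠ a₀ ∧ D.g a x = 0) ∨ (∃ b, D.h b x = 0) → f x = x) ∧
      f '' D.insideWithWall a₀ = D.inside := by
  obtain ⟨f₀, hf₀, hid₀, hsub, hcov⟩ := D.exists_push_wall a₀ hvg hvh
  suffices ∃ f : EuclideanSpace ℝ (Fin n) → EuclideanSpace ℝ (Fin n), IsPolynomialMap f ∧
      (∀ x, D.tau x = 0 ∨ D.rho x = 0 → f x = x) ∧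
      f '' (f₀ '' D.insideWithWall a₀) = D.inside by
    obtain ⟨f, hf, hid, himg⟩ := this
    refine ⟨f ∘ f₀, hf.comp hf₀, fun x hx => ?_, by rw [Set.image_comp, himg]⟩
    rw [Function.comp_apply, hid₀ x hx]
    refine hid x ?_
    rcases hx with ⟨a, -, h⟩ | ⟨b, h⟩
    · exact Or.inl (Finset.prod_eq_zero (Finset.mem_univ a) h)
    · exact Or.inr (D.rho_eq_zero h)
  rcases isEmpty_or_nonempty β with hβ | hβ
  · exact D.exists_map_of_isEmpty hsub fun y hy h => hcov y hy (Or.inl h)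
  · have hS : D.Covers (3 * Fintype.card α + 2 * Fintype.card β + 1) ∅
        (f₀ '' D.insideWithWall a₀) := by
      refine ⟨hsub, fun y hy hcase => hcov y hy ?_⟩
      have hτ := D.tau_pos hy
      have hY := D.two_le_width y
      by_cases hgap : 1 ≤ D.tau y * D.width y
      · left
        nlinarith [mul_nonneg hτ.le (sq_nonneg (D.ell y))]
      push Not at hgap
      rcases hcase with h | h | h | ⟨b, hb, -⟩
      · linarith
      · left
        have hτ1 : D.tau y ≤ 1 := by nlinarith
        have hell : 0 < D.ell y := pos_of_mul_pos_right (one_pos.trans_le h) (by positivity)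
        have h1 : 1 ≤ D.tau y * D.ell y := by
          refine h.trans (mul_le_mul_of_nonneg_right ?_ hell.le)
          exact pow_le_of_le_one hτ.le hτ1 (by omega)
        have h2 : 1 ≤ D.ell y := by nlinarith
        nlinarith [mul_pos hτ hell]
      · exact Or.inr ⟨hgap, h⟩
      · exact absurd hb (Set.notMem_empty b)
    obtain ⟨f, A', -, hf, hid, hcovers⟩ := D.exists_contractions (by omega) hS Finset.univ
    refine ⟨f, hf, hid, Set.Subset.antisymm hcovers.subset fun y hy => ?_⟩
    obtain ⟨b, -, hb⟩ := Finset.exists_min_image Finset.univ (fun c => D.h c y)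
      Finset.univ_nonempty
    exact hcovers.mem y hy (Or.inr (Or.inr (Or.inr
      ⟨b, by simp, fun c => hb c (Finset.mem_univ c)⟩)))

end Prism

/-- A wall `h i₀ = 0` with an unbounded direction `w` is removed from a polyhedral set `{h ≥ 0}` by a
polynomial map that fixes all the other walls. -/
theorem exists_map_removing_wall {n : ℕ} {ι : Type} [Fintype ι]
    (h : ι → (EuclideanSpace ℝ (Fin n) →ᵃ[ℝ] ℝ)) (i₀ : ι) {v w : EuclideanSpace ℝ (Fin n)}
    (hv : ∀ i, 0 < (h i).linear v) (hw : ∀ i, 0 ≤ (h i).linear w) (hw₀ : (h i₀).linear w = 0)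
    (hw_ne : w ≠ 0) :
    ∃ f : EuclideanSpace ℝ (Fin n) → EuclideanSpace ℝ (Fin n), IsPolynomialMap f ∧
      (∀ x, ∀ i, i ≠ i₀ → h i x = 0 → f x = x) ∧
      f '' {x | (∀ i, i ≠ i₀ → 0 < h i x) ∧ 0 ≤ h i₀ x} = {x | ∀ i, 0 < h i x} := by
  classical
  let D : Prism n {i // (h i).linear w = 0} {i // (h i).linear w ≠ 0} :=
    { g := fun i => h i
      h := fun i => ((h i).linear w)⁻¹ • h i
      -- Any affine function of slope one along `w` would do.
      ell := ((‖w‖ ^ 2)⁻¹ • (innerSL ℝ w : EuclideanSpace ℝ (Fin n) →ₗ[ℝ] ℝ)).toAffineMap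
      w := w
      g_w := fun i => i.2
      h_w := fun i => by simpa using inv_mul_cancel₀ i.2
      ell_w := by
        have : ‖w‖ ^ 2 ≠ 0 := by positivity
        simp [this] }
  have hpos : ∀ i : {i // (h i).linear w ≠ 0}, 0 < ((h i).linear w)⁻¹ := fun i =>
    inv_pos.2 ((hw i).lt_of_ne' i.2)
  have hDh : ∀ i x, D.h i x = ((h i).linear w)⁻¹ * h i x := fun i x => rfl
  have hDh0 : ∀ i x, 0 < D.h i x ↔ 0 < h i x := fun i x => by
    rw [hDh]; exact mul_pos_iff_of_pos_left (hpos i)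
  obtain ⟨f, hf, hid, himg⟩ := D.exists_map ⟨i₀, hw₀⟩ (v := v) (fun i => hv i)
    (fun i => mul_pos (hpos i) (hv i))
  have hin : D.inside = {x | ∀ i, 0 < h i x} := by
    ext x
    constructor
    · rintro ⟨h1, h2⟩ i
      by_cases hi : (h i).linear w = 0
      · exact h1 ⟨i, hi⟩
      · exact (hDh0 ⟨i, hi⟩ x).1 (h2 ⟨i, hi⟩)
    · intro hx
      exact ⟨fun i => hx i, fun i => (hDh0 i x).2 (hx i)⟩
  have hwall : D.insideWithWall ⟨i₀, hw₀⟩ = {x | (∀ i, i ≠ i₀ → 0 < h i x) ∧ 0 ≤ h i₀ x} := by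
    ext x
    constructor
    · rintro ⟨h1, h2, h3⟩
      refine ⟨fun i hii => ?_, h3⟩
      by_cases hi : (h i).linear w = 0
      · exact h1 ⟨i, hi⟩ fun he => hii (congrArg Subtype.val he)
      · exact (hDh0 ⟨i, hi⟩ x).1 (h2 ⟨i, hi⟩)
    · rintro ⟨h1, h2⟩
      refine ⟨fun i hi => h1 i fun he => hi (Subtype.ext he), fun i => (hDh0 i x).2 (h1 i ?_), h2⟩
      intro he
      exact i.2 (he ▸ hw₀)
  refine ⟨f, hf, fun x i hii hx => hid x ?_, by rw [← hwall, himg, hin]⟩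
  by_cases hi : (h i).linear w = 0
  · exact Or.inl ⟨⟨i, hi⟩, fun he => hii (congrArg Subtype.val he), hx⟩
  · exact Or.inr ⟨⟨i, hi⟩, by rw [hDh, hx, mul_zero]⟩

end PolyhedronImage

/-! ### Minimal families, facets and codimension-two faces -/

namespace PolyhedronImage

variable {n : ℕ}

theorem affineMap_linear_sub (h : EuclideanSpace ℝ (Fin n) →ᵃ[ℝ] ℝ)
    (x y : EuclideanSpace ℝ (Fin n)) : h.linear (x - y) = h x - h y := by
  simpa using h.linearMap_vsub x y

theorem eq_zero_of_mem_affineSpan {h : EuclideanSpace ℝ (Fin n) →ᵃ[ℝ] ℝ}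
    {S : Set (EuclideanSpace ℝ (Fin n))} (hS : ∀ x ∈ S, h x = 0) {x : EuclideanSpace ℝ (Fin n)}
    (hx : x ∈ affineSpan ℝ S) : h x = 0 := by
  refine affineSpan_induction (p := fun x => h x = 0) hx hS fun c u v w hu hv hw => ?_
  rw [vsub_eq_sub, vadd_eq_add, add_comm, affineMap_add_smul, affineMap_linear_sub, hu, hv, hw]
  simp

/-- A point of a polyhedral set can be moved in both directions along a vector that is parallel to
the walls through the point. -/
theorem exists_move {ι : Type*} [Finite ι] {h : ι → (EuclideanSpace ℝ (Fin n) →ᵃ[ℝ] ℝ)}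
    {a y : EuclideanSpace ℝ (Fin n)} (H : ∀ i, 0 < h i a ∨ (h i a = 0 ∧ (h i).linear y = 0)) :
    ∃ ε : ℝ, 0 < ε ∧ (∀ i, 0 ≤ h i (a + ε • y)) ∧ ∀ i, 0 ≤ h i (a + (-ε) • y) := by
  have hev : ∀ᶠ s : ℝ in nhds 0, ∀ i, 0 ≤ h i (a + s • y) := by
    refine Filter.eventually_all.2 fun i => ?_
    simp only [affineMap_add_smul]
    rcases H i with h1 | ⟨h1, h2⟩
    · have hc : Continuous fun s : ℝ => h i a + s * (h i).linear y := by fun_prop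
      have := hc.continuousAt (x := 0) |>.eventually (lt_mem_nhds (a := 0) (by simpa using h1))
      exact this.mono fun s hs => hs.le
    · exact Filter.Eventually.of_forall fun s => by rw [h1, h2]; simp
  obtain ⟨δ, hδ, hs⟩ := Metric.eventually_nhds_iff.1 hev
  refine ⟨δ / 2, by positivity, hs ?_, hs ?_⟩ <;>
    simp [abs_of_pos hδ] <;> linarith

/-- An affine function that vanishes at `a` and is constant along the hyperplane through `a` on which
another one vanishes is a multiple of the latter. -/
theorem exists_eq_mul {h h' : EuclideanSpace ℝ (Fin n) →ᵃ[ℝ] ℝ} {a v : EuclideanSpace ℝ (Fin n)}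
    (hv : h.linear v ≠ 0) (ha : h a = 0) (ha' : h' a = 0)
    (H : ∀ y, h.linear y = 0 → h'.linear y = 0) : ∃ μ : ℝ, ∀ x, h' x = μ * h x := by
  refine ⟨h'.linear v / h.linear v, fun x => ?_⟩
  have h1 := H (x - a - (h.linear (x - a) / h.linear v) • v) (by
    rw [map_sub, map_smul, smul_eq_mul, div_mul_cancel₀ _ hv, sub_self])
  rw [map_sub, map_smul, smul_eq_mul, affineMap_linear_sub, affineMap_linear_sub, ha, ha'] at h1
  linear_combination h1

theorem submodule_eq_top_of_recessionCone {K : Set (EuclideanSpace ℝ (Fin n))}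
    (hrec : affineDim (recessionCone K) = n) {W : Submodule ℝ (EuclideanSpace ℝ (Fin n))}
    (hW : ∀ v ∈ recessionCone K, v ∈ W) : W = ⊤ := by
  have h1 : (affineSpan ℝ (recessionCone K)).direction = ⊤ :=
    Submodule.eq_top_of_finrank_eq (by rw [finrank_euclideanSpace_fin]; exact hrec)
  rw [eq_top_iff, ← h1, direction_affineSpan, vectorSpan_def, Submodule.span_le]
  rintro _ ⟨x, hx, y, hy, rfl⟩
  exact W.sub_mem (hW x hx) (hW y hy)

theorem affineSpan_eq_top {K : Set (EuclideanSpace ℝ (Fin n))}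
    (hrec : affineDim (recessionCone K) = n) (hne : K.Nonempty) : affineSpan ℝ K = ⊤ := by
  obtain ⟨p, hp⟩ := hne
  have hp' : p ∈ affineSpan ℝ K := subset_affineSpan ℝ K hp
  rw [← AffineSubspace.direction_eq_top_iff_of_nonempty ⟨p, hp'⟩]
  refine submodule_eq_top_of_recessionCone hrec fun v hv => ?_
  have h1 : p + (1 : ℝ) • v ∈ affineSpan ℝ K := subset_affineSpan ℝ K (hv p hp 1 zero_le_one)
  have h2 := AffineSubspace.vsub_mem_direction h1 hp'
  simpa using h2

/-- A description of a polyhedron with interior points by a minimal family of inequalities. -/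
structure IsMinimalRep (K : Set (EuclideanSpace ℝ (Fin n))) {m : ℕ}
    (h : Fin m → (EuclideanSpace ℝ (Fin n) →ᵃ[ℝ] ℝ)) : Prop where
  eq : K = {x | ∀ i, 0 ≤ h i x}
  exists_on_wall : ∀ i, ∃ a, h i a = 0 ∧ ∀ j, j ≠ i → 0 < h j a
  exists_pos : ∃ v, ∀ i, 0 < (h i).linear v

/-- Each `h j` is non-negative on the recession cone and, the cone being full-dimensional, positive
somewhere on it; summing such vectors gives `v`. By minimality some point violates only `h j`; the
segment from it to an interior point crosses wall `j` off all other walls. -/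
theorem IsFacet.exists_isMinimalRep {K F : Set (EuclideanSpace ℝ (Fin n))}
    (hrec : affineDim (recessionCone K) = n) (hF : IsFacet K F) :
    ∃ (m : ℕ) (h : Fin m → (EuclideanSpace ℝ (Fin n) →ᵃ[ℝ] ℝ)), IsMinimalRep K h ∧
      ∃ i, F = K ∩ {x | h i x = 0} := by
  obtain ⟨m, h, hne, hK, hmin, i, hi⟩ := hF
  have hKne : K.Nonempty := by
    obtain ⟨x, hx, -⟩ := hne i
    exact (affineSpan_nonempty ℝ).1 ⟨x, hx⟩
  rw [affineSpan_eq_top hrec hKne] at hne hK hmin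
  simp only [AffineSubspace.mem_top, true_and] at hne hK hmin
  obtain ⟨p, hp⟩ := hKne
  have hlin : ∀ v ∈ recessionCone K, ∀ j, 0 ≤ (h j).linear v := by
    intro v hv j
    by_contra hcon
    push Not at hcon
    have hp0 : 0 ≤ h j p := by rw [hK] at hp; exact hp j
    have h1 := hv p hp ((h j p + 1) / (-(h j).linear v)) (by
      apply div_nonneg <;> linarith)
    rw [hK] at h1
    have h2 := h1 j
    rw [affineMap_add_smul, div_mul_eq_mul_div, div_neg, mul_div_cancel_right₀ _ hcon.ne] at h2
    linarith
  have hv : ∃ v, ∀ j, 0 < (h j).linear v := by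
    have hex : ∀ j, ∃ v ∈ recessionCone K, 0 < (h j).linear v := by
      intro j
      by_contra hcon
      push Not at hcon
      have htop := submodule_eq_top_of_recessionCone (W := LinearMap.ker (h j).linear) hrec
        fun v hv => LinearMap.mem_ker.2 (le_antisymm (hcon v hv) (hlin v hv j))
      obtain ⟨x, y, hxy⟩ := hne j
      apply hxy
      have : x - y ∈ LinearMap.ker (h j).linear := by rw [htop]; trivial
      rw [LinearMap.mem_ker, affineMap_linear_sub] at this
      linarith
    choose v hvrec hvpos using hex
    refine ⟨∑ j, v j, fun j => ?_⟩
    rw [map_sum]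
    exact Finset.sum_pos' (fun l _ => hlin _ (hvrec l) j) ⟨j, Finset.mem_univ j, hvpos j⟩
  refine ⟨m, h, ⟨hK, fun j => ?_, hv⟩, i, hi⟩
  obtain ⟨v, hv⟩ := hv
  obtain ⟨x, hxj, hx⟩ : ∃ x, h j x < 0 ∧ ∀ l, l ≠ j → 0 ≤ h l x := by
    by_contra hcon
    push Not at hcon
    refine hmin j (Set.Subset.antisymm ?_ ?_)
    · intro x hx l _
      rw [hK] at hx
      exact hx l
    · intro x hx
      rw [hK]
      intro l
      by_cases hl : l = j
      · subst hl
        by_contra h0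
        push Not at h0
        obtain ⟨l', hl', hlt⟩ := hcon x h0
        exact absurd (hx l' hl') (not_le.2 hlt)
      · exact hx l hl
  have hq : ∀ l, 0 < h l (p + (1 : ℝ) • v) := fun l => by
    rw [affineMap_add_smul]
    have : 0 ≤ h l p := by rw [hK] at hp; exact hp l
    linarith [hv l]
  set q := p + (1 : ℝ) • v with hqdef
  have hden : 0 < h j q - h j x := by linarith [hq j]
  set s := -h j x / (h j q - h j x) with hs
  have hs0 : 0 < s := div_pos (by linarith) hden
  have hs1 : s < 1 := by rw [hs, div_lt_one hden]; linarith [hq j]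
  refine ⟨x + s • (q - x), ?_, fun l hl => ?_⟩
  · rw [affineMap_add_smul, affineMap_linear_sub, hs, div_mul_cancel₀ _ hden.ne']
    ring
  · rw [affineMap_add_smul, affineMap_linear_sub]
    nlinarith [hx l hl, mul_pos hs0 (hq l), mul_nonneg (sub_nonneg.2 hs1.le) (hx l hl)]

namespace IsMinimalRep

variable {K : Set (EuclideanSpace ℝ (Fin n))} {m : ℕ}
  {h : Fin m → (EuclideanSpace ℝ (Fin n) →ᵃ[ℝ] ℝ)}

theorem mem_iff (hK : IsMinimalRep K h) {x : EuclideanSpace ℝ (Fin n)} :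
    x ∈ K ↔ ∀ i, 0 ≤ h i x := by rw [hK.eq]; rfl

/-- If one wall function vanishes where another one does, then they belong to the same wall. -/
theorem eq_of_eq_mul (hK : IsMinimalRep K h) {i j : Fin m} {μ : ℝ}
    (hμ : ∀ x, h j x = μ * h i x) : j = i := by
  by_contra hij
  obtain ⟨a, ha, hpos⟩ := hK.exists_on_wall i
  have := hpos j hij
  rw [hμ, ha, mul_zero] at this
  exact lt_irrefl _ this

/-- The walls do not depend on the minimal family. -/
theorem exists_wall_eq (hK : IsMinimalRep K h) {m' : ℕ}
    {h' : Fin m' → (EuclideanSpace ℝ (Fin n) →ᵃ[ℝ] ℝ)} (hK' : IsMinimalRep K h') (i : Fin m') :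
    ∃ j, ∀ x, h j x = 0 ↔ h' i x = 0 := by
  obtain ⟨a, ha, hpos⟩ := hK'.exists_on_wall i
  obtain ⟨v, hv⟩ := hK'.exists_pos
  obtain ⟨v₁, hv₁⟩ := hK.exists_pos
  have haK : a ∈ K := hK'.mem_iff.2 fun l => by
    by_cases hl : l = i
    · rw [hl, ha]
    · exact (hpos l hl).le
  -- Otherwise `a` could be moved along `-v` within `K`, but `h' i` would become negative.
  obtain ⟨j, hj⟩ : ∃ j, h j a = 0 := by
    by_contra hcon
    push Not at hcon
    obtain ⟨ε, hε, -, hmove⟩ := exists_move (h := h) (a := a) (y := v)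
      fun l => Or.inl ((hK.mem_iff.1 haK l).lt_of_ne' (hcon l))
    have h1 := hK'.mem_iff.1 (hK.mem_iff.2 hmove) i
    rw [affineMap_add_smul, ha] at h1
    nlinarith [mul_pos hε (hv i)]
  -- `a` is in the relative interior of wall `i`, so `h j`, non-negative on `K` and zero at `a`, is
  -- constant along that wall.
  obtain ⟨μ, hμ⟩ := exists_eq_mul (h := h' i) (h' := h j) (hv i).ne' ha hj fun y hy => by
    obtain ⟨ε, hε, hm1, hm2⟩ := exists_move (h := h') (a := a) (y := y) fun l => by
      by_cases hl : l = i
      · exact Or.inr ⟨hl ▸ ha, hl ▸ hy⟩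
      · exact Or.inl (hpos l hl)
    have h1 := hK.mem_iff.1 (hK'.mem_iff.2 hm1) j
    have h2 := hK.mem_iff.1 (hK'.mem_iff.2 hm2) j
    rw [affineMap_add_smul, hj] at h1 h2
    have h3 : 0 ≤ (h j).linear y := by
      by_contra h4
      push Not at h4
      nlinarith [mul_pos hε (neg_pos.2 h4)]
    have h5 : (h j).linear y ≤ 0 := by
      by_contra h4
      push Not at h4
      nlinarith [mul_pos hε h4]
    linarith
  have hμ0 : μ ≠ 0 := by
    rintro rfl
    have h1 := hμ (a + (1 : ℝ) • v₁)
    rw [affineMap_add_smul, hj] at h1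
    linarith [hv₁ j]
  exact ⟨j, fun x => by rw [hμ]; simp [hμ0]⟩

theorem exists_facet_eq (hK : IsMinimalRep K h) (hrec : affineDim (recessionCone K) = n)
    {G : Set (EuclideanSpace ℝ (Fin n))} (hG : IsFacet K G) : ∃ j, G = K ∩ {x | h j x = 0} := by
  obtain ⟨m', h', hK', i, hi⟩ := hG.exists_isMinimalRep hrec
  obtain ⟨j, hj⟩ := hK.exists_wall_eq hK' i
  refine ⟨j, ?_⟩
  rw [hi]
  ext x
  simp [hj x]

theorem mem_affineSpan_wall_iff (hK : IsMinimalRep K h) (i : Fin m)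
    {x : EuclideanSpace ℝ (Fin n)} :
    x ∈ affineSpan ℝ (K ∩ {x | h i x = 0}) ↔ h i x = 0 := by
  refine ⟨eq_zero_of_mem_affineSpan fun x hx => hx.2, fun hx => ?_⟩
  obtain ⟨a, ha, hpos⟩ := hK.exists_on_wall i
  have hlin : (h i).linear (x - a) = 0 := by rw [affineMap_linear_sub, hx, ha, sub_zero]
  obtain ⟨ε, hε, hm1, -⟩ := exists_move (h := h) (a := a) (y := x - a) fun l => by
    by_cases hl : l = i
    · exact Or.inr ⟨hl ▸ ha, hl ▸ hlin⟩
    · exact Or.inl (hpos l hl)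
  have h1 : a ∈ affineSpan ℝ (K ∩ {x | h i x = 0}) := subset_affineSpan ℝ _
    ⟨hK.mem_iff.2 fun l => by
      by_cases hl : l = i
      · rw [hl, ha]
      · exact (hpos l hl).le, ha⟩
  have h2 : a + ε • (x - a) ∈ affineSpan ℝ (K ∩ {x | h i x = 0}) := subset_affineSpan ℝ _
    ⟨hK.mem_iff.2 hm1, by
      show h i _ = 0
      rw [affineMap_add_smul, hlin, ha]; simp⟩
  have h3 := AffineSubspace.smul_vsub_vadd_mem _ ε⁻¹ h2 h1 h1
  have h4 : ε⁻¹ • (a + ε • (x - a) -ᵥ a) +ᵥ a = x := by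
    rw [vsub_eq_sub, vadd_eq_add, add_sub_cancel_left, smul_smul, inv_mul_cancel₀ hε.ne', one_smul,
      sub_add_cancel]
  rwa [h4] at h3

/-- A linear function that is non-negative around a point of the relative interior of a wall, and
vanishes there, is constant along the wall. -/
theorem linear_eq_zero {i : Fin m} {a : EuclideanSpace ℝ (Fin n)}
    (ha : h i a = 0) {s : Set (Fin m)} (hpos : ∀ j ∈ s, 0 < h j a)
    (hs : K ∩ {x | h i x = 0} = {x | h i x = 0 ∧ ∀ j ∈ s, 0 ≤ h j x})
    {g : EuclideanSpace ℝ (Fin n) →ᵃ[ℝ] ℝ} (hg : ∀ x ∈ K ∩ {x | h i x = 0}, 0 ≤ g x)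
    (hga : g a = 0) {y : EuclideanSpace ℝ (Fin n)} (hy : (h i).linear y = 0) :
    g.linear y = 0 := by
  obtain ⟨ε, hε, hm1, hm2⟩ := exists_move (h := fun j : s => h j) (a := a) (y := y)
    fun l => Or.inl (hpos l l.2)
  have key : ∀ r : ℝ, (∀ j : s, 0 ≤ h j (a + r • y)) → 0 ≤ r * g.linear y := by
    intro r hr
    have h1 : a + r • y ∈ K ∩ {x | h i x = 0} := by
      rw [hs]
      exact ⟨by rw [affineMap_add_smul, ha, hy]; simp, fun j hj => hr ⟨j, hj⟩⟩
    have h2 := hg _ h1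
    rw [affineMap_add_smul, hga] at h2
    linarith
  have h1 := key ε hm1
  have h2 := key (-ε) hm2
  have h3 : ε * g.linear y = 0 := by linarith
  exact (mul_eq_zero.1 h3).resolve_left hε.ne'

theorem mem_codimTwoUnion (hK : IsMinimalRep K h) {i j : Fin m}
    (hfacet : IsFacet K (K ∩ {x | h i x = 0})) (hij : j ≠ i) {x : EuclideanSpace ℝ (Fin n)}
    (hx : x ∈ K) (hxi : h i x = 0) (hxj : h j x = 0) : x ∈ codimTwoUnion K := by
  classical
  set F := K ∩ {x | h i x = 0} with hF
  obtain ⟨a, ha, hapos⟩ := hK.exists_on_wall i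
  have haF : a ∈ F := ⟨hK.mem_iff.2 fun l => by
      by_cases hl : l = i
      · rw [hl, ha]
      · exact (hapos l hl).le, ha⟩
  set s₀ : Finset (Fin m) := Finset.univ.filter fun l =>
    ∃ x ∈ affineSpan ℝ F, ∃ y ∈ affineSpan ℝ F, h l x ≠ h l y with hs₀
  set 𝒮 : Set (Finset (Fin m)) :=
    {s | s ⊆ s₀ ∧ F = {x | x ∈ affineSpan ℝ F ∧ ∀ l ∈ s, 0 ≤ h l x}} with h𝒮
  have hne : 𝒮.Nonempty := by
    refine ⟨s₀, subset_rfl, Set.Subset.antisymm (fun x hx =>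
      ⟨subset_affineSpan ℝ F hx, fun l _ => hK.mem_iff.1 hx.1 l⟩) ?_⟩
    rintro x ⟨hxA, hxs⟩
    refine ⟨hK.mem_iff.2 fun l => ?_, (hK.mem_affineSpan_wall_iff i).1 hxA⟩
    by_cases hl : l ∈ s₀
    · exact hxs l hl
    · simp only [hs₀, Finset.mem_filter, Finset.mem_univ, true_and] at hl
      push Not at hl
      rw [hl x hxA a (subset_affineSpan ℝ F haF)]
      exact hK.mem_iff.1 haF.1 l
  -- A minimal subfamily cutting out `F` within its span is what `IsFacet F _` requires.
  obtain ⟨s, ⟨hss₀, hsF⟩, hsmin⟩ := wellFounded_lt.has_min 𝒮 hne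
  have hsF' : F = {x | h i x = 0 ∧ ∀ l ∈ (s : Set (Fin m)), 0 ≤ h l x} := by
    refine hsF.trans ?_
    ext x
    simp only [Set.mem_ofPred_eq, Finset.mem_coe]
    rw [hK.mem_affineSpan_wall_iff i]
  -- If none vanished at `x`, then `x` would be in the relative interior of `F`, and `h j` would be
  -- a multiple of `h i`.
  obtain ⟨l, hls, hlx⟩ : ∃ l ∈ s, h l x = 0 := by
    by_contra hcon
    push Not at hcon
    obtain ⟨v, hv⟩ := hK.exists_pos
    obtain ⟨μ, hμ⟩ := exists_eq_mul (h := h i) (h' := h j) (hv i).ne' hxi hxj fun y hy =>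
      linear_eq_zero hxi (s := s)
        (fun l hl => (hK.mem_iff.1 hx l).lt_of_ne' (hcon l hl)) hsF'
        (fun z hz => hK.mem_iff.1 hz.1 j) hxj hy
    exact hij (hK.eq_of_eq_mul hμ)
  refine ⟨F, F ∩ {x | h l x = 0}, hfacet, ?_, subset_affineSpan ℝ _ ⟨⟨hx, hxi⟩, hlx⟩⟩
  have hforall : ∀ {p : Fin m → Prop}, (∀ k, p (s.equivFin.symm k)) ↔ ∀ l ∈ s, p l := by
    intro p
    rw [s.equivFin.symm.forall_congr_left]
    simp
  refine ⟨s.card, fun k => h (s.equivFin.symm k), fun k => ?_, ?_, fun k hk => ?_,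
    s.equivFin ⟨l, hls⟩, by simp⟩
  · have := hss₀ (s.equivFin.symm k).2
    simpa [hs₀] using this
  · refine hsF.trans ?_
    ext x
    simp only [Set.mem_ofPred_eq]
    rw [hforall (p := fun l => 0 ≤ h l x)]
  · set l' : Fin m := ((s.equivFin.symm k : s) : Fin m) with hl'
    have hl's : l' ∈ s := (s.equivFin.symm k).2
    refine hsmin (s.erase l') ⟨(Finset.erase_subset _ _).trans hss₀, hk.trans ?_⟩
      (Finset.erase_ssubset hl's)
    ext x
    simp only [Set.mem_ofPred_eq, Finset.mem_erase]
    refine and_congr_right fun _ => ⟨fun H l hl => ?_, fun H k' hk' => ?_⟩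
    · have := H (s.equivFin ⟨l, hl.2⟩) fun he => hl.1 (by rw [hl', ← he]; simp)
      simpa using this
    · refine H _ ⟨fun he => hk' ?_, (s.equivFin.symm k').2⟩
      exact s.equivFin.symm.injective (Subtype.ext he)

/-- If `x` were in the span of a facet of a facet, the latter would lie on wall `i`. The function
defining the former vanishes at `x`, in the relative interior of that wall, so it would be constant
there, which `IsFacet` excludes. -/
theorem notMem_codimTwoUnion (hK : IsMinimalRep K h) (hrec : affineDim (recessionCone K) = n)
    {i : Fin m} {x : EuclideanSpace ℝ (Fin n)} (hxi : 0 ≤ h i x)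
    (hpos : ∀ j, j ≠ i → 0 < h j x) : x ∉ codimTwoUnion K := by
  rintro ⟨G, E, hG, hE, hxE⟩
  obtain ⟨j, rfl⟩ := hK.exists_facet_eq hrec hG
  obtain ⟨m', g, hgne, hgeq, -, l, rfl⟩ := hE
  have hxj : h j x = 0 := eq_zero_of_mem_affineSpan (fun z hz => hz.1.2) hxE
  have hji : j = i := by
    by_contra hne
    exact (hpos j hne).ne' hxj
  subst hji
  have hxl : g l x = 0 := eq_zero_of_mem_affineSpan (fun z hz => hz.2) hxE
  obtain ⟨y, hy, z, hz, hyz⟩ := hgne l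
  rw [hK.mem_affineSpan_wall_iff] at hy hz
  apply hyz
  have h1 := linear_eq_zero (g := g l) hxj (s := {k | k ≠ j}) hpos (by
      ext x
      constructor
      · rintro ⟨h1, h2⟩
        exact ⟨h2, fun k _ => hK.mem_iff.1 h1 k⟩
      · rintro ⟨h1, h2⟩
        refine ⟨hK.mem_iff.2 fun k => ?_, h1⟩
        by_cases hk : k = j
        · rw [hk, h1]
        · exact h2 k hk)
    (fun x hx => by rw [hgeq] at hx; exact hx.2 l) hxl
    (y := y - z) (by rw [affineMap_linear_sub, hy, hz, sub_zero])
  rw [affineMap_linear_sub] at h1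
  linarith

end IsMinimalRep

/-- An unbounded set of the form `{h ≥ 0, h i = 0}` contains rays. -/
theorem exists_direction_of_unbounded {ι : Type*} {h : ι → (EuclideanSpace ℝ (Fin n) →ᵃ[ℝ] ℝ)}
    {i₀ : ι} {S : Set (EuclideanSpace ℝ (Fin n))} (hS : ∀ x ∈ S, (∀ i, 0 ≤ h i x) ∧ h i₀ x = 0)
    (hunb : ¬ Bornology.IsBounded S) :
    ∃ w : EuclideanSpace ℝ (Fin n), w ≠ 0 ∧ (∀ i, 0 ≤ (h i).linear w) ∧ (h i₀).linear w = 0 := by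
  have hex : ∀ k : ℕ, ∃ x ∈ S, (k : ℝ) + 1 < ‖x‖ := by
    intro k
    by_contra hcon
    push Not at hcon
    exact hunb (isBounded_iff_forall_norm_le.2 ⟨k + 1, hcon⟩)
  choose x hxS hx using hex
  have hnorm : ∀ k, 0 < ‖x k‖ := fun k => lt_trans (by positivity) (hx k)
  have hu : ∀ k, ‖x k‖⁻¹ • x k ∈ Metric.sphere (0 : EuclideanSpace ℝ (Fin n)) 1 := fun k => by
    rw [mem_sphere_zero_iff_norm, norm_smul, norm_inv, norm_norm, inv_mul_cancel₀ (hnorm k).ne']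
  obtain ⟨w, hw, φ, hφ, hlim⟩ := (isCompact_sphere _ _).tendsto_subseq hu
  have hinv : Filter.Tendsto (fun k => ‖x (φ k)‖⁻¹) Filter.atTop (nhds 0) := by
    have h1 : Filter.Tendsto (fun k => ‖x k‖) Filter.atTop Filter.atTop :=
      Filter.tendsto_atTop_mono (fun k => by linarith [hx k]) tendsto_natCast_atTop_atTop
    exact (tendsto_inv_atTop_zero.comp h1).comp hφ.tendsto_atTop
  have hlin : ∀ i, Filter.Tendsto (fun k => ‖x (φ k)‖⁻¹ * h i (x (φ k))) Filter.atTop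
      (nhds ((h i).linear w)) := by
    intro i
    have hc : Continuous (h i).linear := (h i).linear.continuous_of_finiteDimensional
    have h1 := ((hc.tendsto w).comp hlim).add (hinv.mul_const (h i 0))
    rw [zero_mul, add_zero] at h1
    refine h1.congr fun k => ?_
    have h2 := affineMap_linear_sub (h i) (x (φ k)) 0
    rw [sub_zero] at h2
    simp only [Function.comp_apply, map_smul, smul_eq_mul]
    rw [h2]
    ring
  refine ⟨w, ?_, fun i => ?_, ?_⟩
  · rintro rfl
    simp at hw
  · exact ge_of_tendsto' (hlin i) fun k =>
      mul_nonneg (inv_nonneg.2 (norm_nonneg _)) ((hS _ (hxS _)).1 i)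
  · refine tendsto_nhds_unique (hlin i₀) ?_
    simp only [(hS _ (hxS _)).2, mul_zero]
    exact tendsto_const_nhds

end PolyhedronImage

/-! ### Conclusion -/

theorem proposition5p3 {n : ℕ} (K : Set (EuclideanSpace ℝ (Fin n)))
    (hK : PolyhedronImage.IsConvexPolyhedron K)
    (hrec : PolyhedronImage.affineDim (PolyhedronImage.recessionCone K) = n)
    (F : Set (EuclideanSpace ℝ (Fin n)))
    (hF : PolyhedronImage.IsFacet K F)
    (hF_unbdd : ¬ Bornology.IsBounded F)
    (𝒢 : Set (Set (EuclideanSpace ℝ (Fin n))))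
    (h𝒢 : ∀ G ∈ 𝒢, PolyhedronImage.IsFacet K G ∧ G ≠ F)
    (T : Set (EuclideanSpace ℝ (Fin n)))
    (hT : T = (K \ PolyhedronImage.codimTwoUnion K) \ ⋃ G ∈ 𝒢, intrinsicInterior ℝ G) :
    ∃ f : EuclideanSpace ℝ (Fin n) → EuclideanSpace ℝ (Fin n),
      PolyhedronImage.IsPolynomialMap f ∧ f '' T = T \ F := by
  obtain ⟨m, h, hrep, i, rfl⟩ := hF.exists_isMinimalRep hrec
  obtain ⟨v, hv⟩ := hrep.exists_pos
  obtain ⟨w, hw_ne, hw, hw₀⟩ := PolyhedronImage.exists_direction_of_unbounded (h := h) (i₀ := i)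
    (fun x hx => ⟨hrep.mem_iff.1 hx.1, hx.2⟩) hF_unbdd
  obtain ⟨f, hf, hid, himg⟩ := PolyhedronImage.exists_map_removing_wall h i hv hw hw₀ hw_ne
  refine ⟨f, hf, ?_⟩
  have hsub : {x | (∀ j, j ≠ i → 0 < h j x) ∧ 0 ≤ h i x} ⊆ T := by
    rintro x ⟨hpos, hx0⟩
    rw [hT]
    refine ⟨⟨hrep.mem_iff.2 fun j => ?_, hrep.notMem_codimTwoUnion hrec hx0 hpos⟩, fun hx => ?_⟩
    · by_cases hj : j = i
      · rw [hj]; exact hx0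
      · exact (hpos j hj).le
    · simp only [Set.mem_iUnion] at hx
      obtain ⟨G, hG, hxG⟩ := hx
      obtain ⟨hGfacet, hGF⟩ := h𝒢 G hG
      obtain ⟨j, rfl⟩ := hrep.exists_facet_eq hrec hGfacet
      have hj : j ≠ i := fun he => hGF (by rw [he])
      exact (hpos j hj).ne' (intrinsicInterior_subset hxG).2
  have hTK : ∀ x ∈ T, ∀ j, 0 ≤ h j x := fun x hx => by
    rw [hT] at hx
    exact hrep.mem_iff.1 hx.1.1
  -- Points of `T` on another wall avoid `F`, as two walls meet `K` together only inside `X`; being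
  -- fixed by `f`, they are their own preimages.
  have hcorner : ∀ x ∈ T, ∀ j, j ≠ i → h j x = 0 → h i x ≠ 0 := fun x hx j hj hxj hxi => by
    have hxK := hrep.mem_iff.2 (hTK x hx)
    rw [hT] at hx
    exact hx.1.2 (hrep.mem_codimTwoUnion hF hj hxK hxi hxj)
  apply Set.Subset.antisymm
  · rintro _ ⟨x, hx, rfl⟩
    by_cases hcase : ∃ j, j ≠ i ∧ h j x = 0
    · obtain ⟨j, hj, hxj⟩ := hcase
      rw [hid x j hj hxj]
      exact ⟨hx, fun hxF => hcorner x hx j hj hxj hxF.2⟩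
    · push Not at hcase
      have hfx : f x ∈ {x | ∀ i, 0 < h i x} := by
        rw [← himg]
        exact ⟨x, ⟨fun j hj => (hTK x hx j).lt_of_ne' (hcase j hj), hTK x hx i⟩, rfl⟩
      exact ⟨hsub ⟨fun j _ => hfx j, (hfx i).le⟩, fun hxF => (hfx i).ne' hxF.2⟩
  · rintro y ⟨hy, hyF⟩
    by_cases hcase : ∃ j, j ≠ i ∧ h j y = 0
    · obtain ⟨j, hj, hyj⟩ := hcase
      exact ⟨y, hy, hid y j hj hyj⟩
    · push Not at hcase
      have hyi : h i y ≠ 0 := fun he => hyF ⟨hrep.mem_iff.2 (hTK y hy), he⟩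
      have hy' : y ∈ {x | ∀ i, 0 < h i x} := fun j => by
        refine (hTK y hy j).lt_of_ne' ?_
        by_cases hj : j = i
        · rw [hj]; exact hyi
        · exact hcase j hj
      rw [← himg] at hy'
      obtain ⟨x, hx, rfl⟩ := hy'
      exact ⟨x, hsub hx, rfl⟩
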